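/- Let $T>0$, let $B=C_0([0,T]\to\mathbb C)$ be the Banach space of continuous paths $\omega:[0,T]\to\mathbb C$ with $\omega(0)=0$ (sup norm, Borel $\sigma$-field), and let $\mu$ be the complex Wiener measure on $B$, i.e. the law of $B^1+iB^2$ for a planar Brownian motion $(B^1,B^2)$; equivalently, the probability measure with $$\int_B e^{i\varphi(\omega)}\,\mu(d\omega)=e^{-\frac12|\varphi|_{H^*}^2}$$ for every continuous real-linear $\varphi:B\to\mathbb R$, where $H=\{h=\int_0^{\cdot}\dot h(s)\,ds:\dot h\in L^2([0,T];\mathbb C)\}\subset B$ is the Cameron–Martin space with inner product $(h,k)_H=\int_0^T\dot h(s)\overline{\dot k(s)}\,ds$ and $|\varphi|_{H^*}$ is the norm of $\varphi|_H$ as a real-linear functional. Let $\{\varphi_k\}_{k\in\mathbb N}\subset B^*$ be continuous complex-linear functionals whose restrictions to $H$ form a complete orthonormal system in $H^*$. With $\partial^* f=-\partial f/\partial\bar z+\frac z2 f$ and $\bar\partial^* f=-\partial f/\partial z+\frac{\bar z}2 f$ (the adjoints of $\partial/\partial z$, $\partial/\partial\bar z$ in $L^2(\mathbb C,\frac1{2\pi}e^{-|z|^2/2}dx\,dy)$),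 let $J_{m,n}(z)=2^{m+n}(\partial^*)^m(\bar\partial^*)^n1$. For finitely supported sequences $\mathbf m=(m_k)$, $\mathbf n=(n_k)$ of nonnegative integers put $$\mathbf J_{\mathbf m,\mathbf n}(x)=\prod_k\frac{1}{\sqrt{2^{m_k+n_k}m_k!\,n_k!}}\,J_{m_k,n_k}(\varphi_k(x)).$$ For $m,n\ge0$ let $\mathcal H_{m,n}$ be the closed linear span in $L^2_{\mathbb C}(B,\mu)$ of the $\mathbf J_{\mathbf m,\mathbf n}$ with $\sum_k m_k=m$, $\sum_k n_k=n$, and let $\mathrm J_{m,n}$ be the orthogonal projection of $L^2_{\mathbb C}(B,\mu)$ onto $\mathcal H_{m,n}$. For $\theta\in(-\frac\pi2,\frac\pi2)$ and $t\ge0$ let $$T_tF(x)=\int_B F\bigl(e^{-(\cos\theta+i\sin\theta)t}x+\sqrt{1-e^{-2t\cos\theta}}\,y\bigr)\,\mu(dy).$$ Then the following hold. 1. For all $m,n\ge 0$ and all $1<p<\infty$, $\mathcal H_{m,n}$ is contained in $L^p(B,\mu)$ and is a closed subspace of it. The norms $\|\cdot\|_p$, $1<p<\infty$, are equivalent on $\mathcal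 H_{m,n}$: for all $1<p,q<\infty$ there is a finite $C$ with $\|F\|_p\le C\|F\|_q$ for all $F\in\mathcal H_{m,n}$. 2. For every $1<p<\infty$, each $\mathrm J_{m,n}$ is bounded in $L^p(B,\mu)$, i.e. there is a bounded operator on $L^p(B,\mu)$, again denoted $\mathrm J_{m,n}$, that agrees with the projection $\mathrm J_{m,n}$ on the dense subspace $L^2\cap L^p$. For all $m,n,i,j\ge0$, these operators on $L^p(B,\mu)$ satisfy $$\mathrm J_{m,n}\mathrm J_{i,j}=\mathrm J_{i,j}\mathrm J_{m,n}=\delta_{m,i}\delta_{n,j}\,\mathrm J_{m,n}.$$ 3. For every $1<p<\infty$, $\theta\in(-\frac\pi2,\frac\pi2)$ and $t\ge0$, the formula above defines, $\mu$-almost everywhere, a bounded operator $T_t$ on $L^p(B,\mu)$, and for all $m,n\ge 0$ $$T_t\mathrm J_{m,n}=\mathrm J_{m,n}T_t=e^{-(m+n)t\cos\theta-i(m-n)t\sin\theta}\,\mathrm J_{m,n}\quad\text{on }L^p(B,\mu).$$ -/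

import Mathlib

open MeasureTheory ProbabilityTheory
open scoped ENNReal NNReal

noncomputable section

namespace ComplexWiener

/-! ### The complex Wiener space -/

/-- The Banach space `B = C₀([0,T] → ℂ)` of continuous paths starting at `0`, with the sup norm,
as a closed complex subspace of `C([0,T], ℂ)`. -/
def pathSubmodule (T : ℝ) : Submodule ℂ C(Set.Icc (0 : ℝ) T, ℂ) where
  carrier := {ω | ∀ t : Set.Icc (0 : ℝ) T, (t : ℝ) = 0 → ω t = 0}
  add_mem' := by
    intro a b ha hb t ht
    simp [ha t ht, hb t ht]
  zero_mem' := by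
    intro t _
    simp
  smul_mem' := by
    intro c a ha t ht
    simp [ha t ht]

abbrev WienerSpace (T : ℝ) : Type := ↥(pathSubmodule T)

/-- `B` carries its Borel σ-algebra. -/
instance instMeasurableSpaceWienerSpace (T : ℝ) : MeasurableSpace (WienerSpace T) :=
  borel (WienerSpace T)

instance instBorelSpaceWienerSpace (T : ℝ) : BorelSpace (WienerSpace T) := ⟨rfl⟩

/-- `L²([0,T]; ℂ)`. The complex Cameron-Martin space `H`, with inner product
`∫₀ᵀ h'(s) conj (k'(s)) ds`, is identified isometrically with it through `h ↦ h'`. -/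
abbrev CameronMartin (T : ℝ) : Type :=
  Lp ℂ 2 ((volume : Measure ℝ).restrict (Set.Icc (0 : ℝ) T))

lemma integrableOn_cameronMartin {T : ℝ} (f : CameronMartin T) :
    IntegrableOn (f : ℝ → ℂ) (Set.Icc (0 : ℝ) T) volume :=
  (Lp.memLp f).integrable (by norm_num)

lemma intervalIntegrable_cameronMartin {T : ℝ} (f : CameronMartin T) {t : ℝ}
    (ht : t ∈ Set.Icc (0 : ℝ) T) : IntervalIntegrable (f : ℝ → ℂ) volume 0 t := by
  rw [intervalIntegrable_iff_integrableOn_Ioc_of_le ht.1]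
  exact (integrableOn_cameronMartin f).mono_set
    (fun x hx => ⟨hx.1.le, hx.2.trans ht.2⟩)

/-- The path `t ↦ ∫₀ᵗ f(s) ds`, i.e. the element `h` of the Cameron-Martin space with `h' = f`. -/
def cameronMartinPath {T : ℝ} (f : CameronMartin T) : WienerSpace T :=
  ⟨⟨fun t => ∫ s in (0 : ℝ)..t, f s, by
      have h : ContinuousOn (fun t : ℝ => ∫ s in (0 : ℝ)..t, f s) (Set.Icc 0 T) := by
        rcases le_or_gt 0 T with hT | hT
        · have := intervalIntegral.continuousOn_primitive_interval
            (f := (f : ℝ → ℂ)) (μ := volume) (a := 0) (b := T)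
            (by rw [Set.uIcc_of_le hT]; exact integrableOn_cameronMartin f)
          rwa [Set.uIcc_of_le hT] at this
        · intro x hx
          exact absurd (hx.1.trans hx.2) (not_le.2 hT)
      exact continuousOn_iff_continuous_domRestrict.1 h⟩, by
    intro t ht
    change ∫ s in (0 : ℝ)..t, f s = 0
    rw [ht, intervalIntegral.integral_same]⟩

lemma norm_cameronMartinPath_le {T : ℝ} (f : CameronMartin T) :
    ‖cameronMartinPath f‖ ≤
      ((volume.restrict (Set.Icc (0 : ℝ) T) Set.univ) ^ ((1 : ℝ) / 2)).toReal * ‖f‖ := by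
  have hfin : (volume.restrict (Set.Icc (0 : ℝ) T) Set.univ) ^ ((1 : ℝ) / 2) ≠ ∞ :=
    ENNReal.rpow_ne_top_of_nonneg (by norm_num) (measure_ne_top _ _)
  have hL1 : ∫ s in Set.Icc (0 : ℝ) T, ‖f s‖ ≤
      ((volume.restrict (Set.Icc (0 : ℝ) T) Set.univ) ^ ((1 : ℝ) / 2)).toReal * ‖f‖ := by
    rw [integral_norm_eq_lintegral_enorm (Lp.aestronglyMeasurable f), Lp.norm_def, mul_comm,
      ← ENNReal.toReal_mul, ← eLpNorm_one_eq_lintegral_enorm]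
    refine ENNReal.toReal_mono (ENNReal.mul_ne_top (Lp.eLpNorm_ne_top f) hfin) ?_
    have := eLpNorm_le_eLpNorm_mul_rpow_measure_univ (p := 1) (q := 2)
      (by norm_num : (1 : ℝ≥0∞) ≤ 2) (Lp.aestronglyMeasurable f)
    convert this using 3
    norm_num
  refine (ContinuousMap.norm_le _ (by positivity)).2 fun t => le_trans ?_ hL1
  change ‖∫ s in (0 : ℝ)..t, f s‖ ≤ _
  rw [intervalIntegral.integral_of_le t.2.1]
  refine (norm_integral_le_integral_norm _).trans ?_
  exact setIntegral_mono_set (integrableOn_cameronMartin f).norm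
    (Filter.Eventually.of_forall fun _ => norm_nonneg _)
    (Filter.Eventually.of_forall fun x hx => ⟨hx.1.le, hx.2.trans t.2.2⟩)

/-- The inclusion of the complex Cameron-Martin space `H` into `B`. -/
def cameronMartinEmbedding (T : ℝ) : CameronMartin T →L[ℂ] WienerSpace T :=
  LinearMap.mkContinuous (E := CameronMartin T) (F := WienerSpace T) (σ := RingHom.id ℂ)
    { toFun := cameronMartinPath
      map_add' := by
        intro f g
        ext t
        change ∫ s in (0 : ℝ)..t, (f + g : CameronMartin T) s =
          (∫ s in (0 : ℝ)..t, f s) + ∫ s in (0 : ℝ)..t, g s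
        rw [← intervalIntegral.integral_add (intervalIntegrable_cameronMartin f t.2)
          (intervalIntegrable_cameronMartin g t.2)]
        refine intervalIntegral.integral_congr_ae ?_
        have h := (ae_restrict_iff' measurableSet_Icc).1 (Lp.coeFn_add f g)
        filter_upwards [h] with x hx hx'
        rw [Set.uIoc_of_le t.2.1] at hx'
        exact hx ⟨hx'.1.le, hx'.2.trans t.2.2⟩
      map_smul' := by
        intro c f
        ext t
        change ∫ s in (0 : ℝ)..t, (c • f : CameronMartin T) s = c • ∫ s in (0 : ℝ)..t, f s
        rw [← intervalIntegral.integral_smul]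
        refine intervalIntegral.integral_congr_ae ?_
        have h := (ae_restrict_iff' measurableSet_Icc).1 (Lp.coeFn_smul c f)
        filter_upwards [h] with x hx hx'
        rw [Set.uIoc_of_le t.2.1] at hx'
        exact hx ⟨hx'.1.le, hx'.2.trans t.2.2⟩ }
    ((volume.restrict (Set.Icc (0 : ℝ) T) Set.univ) ^ ((1 : ℝ) / 2)).toReal
    (fun f => norm_cameronMartinPath_le (T := T) f)

/-- `μ` is the complex Wiener measure on `B`, i.e. the law of planar Brownian motion `B¹ + i B²`
on `[0,T]`: it is the probability measure with characteristic function
`∫ exp(i φ(ω)) dμ(ω) = exp(-|φ|²_{H*} / 2)` for all real-valued continuous real-linear functionals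
`φ` of `B`, where `|φ|_{H*}` is the norm of the restriction of `φ` to the (real Hilbert space
underlying the) Cameron-Martin space. -/
structure IsComplexWienerMeasure {T : ℝ} (μ : Measure (WienerSpace T)) : Prop where
  isProbabilityMeasure : IsProbabilityMeasure μ
  charFunDual_eq : ∀ φ : StrongDual ℝ (WienerSpace T),
    charFunDual μ φ =
      Complex.exp (-(‖φ.comp ((cameronMartinEmbedding T).restrictScalars ℝ)‖ : ℂ) ^ 2 / 2)

/-- The restriction to `H` of a complex-linear functional `φ ∈ B*`, as an element of `H*`,
the latter being identified with `H` by the (conjugate-linear) Riesz isometry. -/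
def rieszRep {T : ℝ} (φ : StrongDual ℂ (WienerSpace T)) : CameronMartin T :=
  (InnerProductSpace.toDual ℂ (CameronMartin T)).symm (φ.comp (cameronMartinEmbedding T))

/-- `{φ_k} ⊆ B*` is a complete orthonormal system in `H*`. -/
def IsCompleteOrthonormalSystem {T : ℝ} (φ : ℕ → StrongDual ℂ (WienerSpace T)) : Prop :=
  Orthonormal ℂ (fun k => rieszRep (φ k)) ∧
    (Submodule.span ℂ (Set.range fun k => rieszRep (φ k))).topologicalClosure = ⊤

/-! ### Hermite-Laguerre-Itô polynomials -/

/-- `∂f/∂z = (∂f/∂x - i ∂f/∂y) / 2`. -/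
def wirtinger (f : ℂ → ℂ) (z : ℂ) : ℂ :=
  (fderiv ℝ f z 1 - Complex.I * fderiv ℝ f z Complex.I) / 2

/-- `∂f/∂z̄ = (∂f/∂x + i ∂f/∂y) / 2`. -/
def wirtingerBar (f : ℂ → ℂ) (z : ℂ) : ℂ :=
  (fderiv ℝ f z 1 + Complex.I * fderiv ℝ f z Complex.I) / 2

/-- The complex creation operator `∂*`, the adjoint of `∂/∂z` in `L²(ν)`,
`dν = (2π)⁻¹ exp(-|z|²/2) dx dy`: `∂* f = -∂f/∂z̄ + (z/2) f`. -/
def creation (f : ℂ → ℂ) (z : ℂ) : ℂ := -wirtingerBar f z + z / 2 * f z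

/-- The adjoint of `∂/∂z̄` in `L²(ν)`: `∂̄* f = -∂f/∂z + (z̄/2) f`. -/
def creationBar (f : ℂ → ℂ) (z : ℂ) : ℂ := -wirtinger f z + (starRingEnd ℂ) z / 2 * f z

/-- `J_{m,n}(z) = 2^{m+n} (∂*)^m (∂̄*)^n 1`. -/
def hermiteLaguerreIto (m n : ℕ) (z : ℂ) : ℂ :=
  2 ^ (m + n) * (creation^[m] (creationBar^[n] fun _ => 1)) z

/-- The Fourier-Hermite-Itô polynomial
`𝐉_{𝐦,𝐧}(x) = ∏_k (2^{m_k+n_k} m_k! n_k!)^{-1/2} J_{m_k,n_k}(⟨x, φ_k⟩)`;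
the factors with `m_k = n_k = 0` are equal to `1`. -/
def fourierHermiteIto {T : ℝ} (φ : ℕ → StrongDual ℂ (WienerSpace T)) (a b : ℕ →₀ ℕ)
    (x : WienerSpace T) : ℂ :=
  ∏ k ∈ a.support ∪ b.support,
    ((1 / √(2 ^ (a k + b k) * (Nat.factorial (a k)) * (Nat.factorial (b k))) : ℝ) : ℂ) *
      hermiteLaguerreIto (a k) (b k) (φ k x)

/-! ### Chaoses, projections, semigroup -/

variable {T : ℝ} (μ : Measure (WienerSpace T)) (φ : ℕ → StrongDual ℂ (WienerSpace T))

/-- The Itô-Wiener chaos `H_{m,n}`: the closed linear span in `L²(B, μ)` of (the classes of) the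
`𝐉_{𝐦,𝐧}` with `|𝐦| = m` and `|𝐧| = n`. -/
def chaos (m n : ℕ) : Submodule ℂ (Lp ℂ 2 μ) :=
  (Submodule.span ℂ {F : Lp ℂ 2 μ | ∃ a b : ℕ →₀ ℕ, (a.sum fun _ i => i) = m ∧
    (b.sum fun _ i => i) = n ∧ F =ᵐ[μ] fourierHermiteIto φ a b}).topologicalClosure

/-- `H_{m,n}` as a subset of `L^p(B, μ)`: the classes in `L^p` that belong to `H_{m,n}`. -/
def chaosLp (p : ℝ≥0∞) (m n : ℕ) : Submodule ℂ (Lp ℂ p μ) where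
  carrier := {G | ∃ F ∈ chaos μ φ m n, G =ᵐ[μ] F}
  add_mem' := by
    rintro G₁ G₂ ⟨F₁, h₁, e₁⟩ ⟨F₂, h₂, e₂⟩
    refine ⟨F₁ + F₂, add_mem h₁ h₂, ?_⟩
    filter_upwards [e₁, e₂, Lp.coeFn_add G₁ G₂, Lp.coeFn_add F₁ F₂] with x a b c d
    rw [c, d, Pi.add_apply, Pi.add_apply, a, b]
  zero_mem' := by
    refine ⟨0, zero_mem _, ?_⟩
    filter_upwards [Lp.coeFn_zero ℂ p μ, Lp.coeFn_zero ℂ 2 μ] with x a b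
    rw [a, b]
  smul_mem' := by
    rintro c G ⟨F, h, e⟩
    refine ⟨c • F, Submodule.smul_mem _ c h, ?_⟩
    filter_upwards [e, Lp.coeFn_smul c G, Lp.coeFn_smul c F] with x a b d
    rw [b, d, Pi.smul_apply, Pi.smul_apply, a]

/-- The orthogonal projection `J_{m,n}` of `L²(B, μ)` onto `H_{m,n}`. -/
def chaosProjection (m n : ℕ) : Lp ℂ 2 μ →L[ℂ] Lp ℂ 2 μ :=
  haveI : CompleteSpace (chaos μ φ m n) := Submodule.topologicalClosure.completeSpace _
  (chaos μ φ m n).starProjection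

/-- The bounded operator `A` on `L^p(B, μ)` is the extension of `J_{m,n}`:
it agrees with `J_{m,n}` on the dense subspace `L² ∩ L^p`. -/
def IsChaosProjectionLp (p : ℝ≥0∞) [Fact (1 ≤ p)] (m n : ℕ) (A : Lp ℂ p μ →L[ℂ] Lp ℂ p μ) : Prop :=
  ∀ (F : Lp ℂ 2 μ) (hF : MemLp F p μ), A (hF.toLp F) =ᵐ[μ] chaosProjection μ φ m n F

/-- `T_t F(x) = ∫ F(e^{-(cos θ + i sin θ) t} x + √(1 - e^{-2 t cos θ}) y) μ(dy)`. -/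
def ouSemigroup (θ t : ℝ) (F : WienerSpace T → ℂ) (x : WienerSpace T) : ℂ :=
  ∫ y, F (Complex.exp (-(Real.cos θ + Complex.I * Real.sin θ) * t) • x +
    ((√(1 - Real.exp (-2 * t * Real.cos θ)) : ℝ) : ℂ) • y) ∂μ

/-- The bounded operator `A` on `L^p(B, μ)` is the Ornstein-Uhlenbeck operator `T_t`:
for every `F` in `L^p(B, μ)` (in particular for every bounded Borel function),
`A F` is almost everywhere given by the integral formula for `T_t F`. -/
def IsOUOperatorLp (p : ℝ≥0∞) [Fact (1 ≤ p)] (θ t : ℝ) (A : Lp ℂ p μ →L[ℂ] Lp ℂ p μ) : Prop :=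
  ∀ (F : WienerSpace T → ℂ) (hF : MemLp F p μ), A (hF.toLp F) =ᵐ[μ] ouSemigroup μ θ t F

end ComplexWiener

end

open MeasureTheory ProbabilityTheory
open scoped ENNReal NNReal

noncomputable section

namespace ComplexWiener

open scoped InnerProductSpace ComplexConjugate

/-! ### Gaussian characteristic functions and rotation invariance -/

section Rotation

/-! Everything rests on one symmetry: comparing characteristic functionals shows that `μ ⊗ μ` is
invariant under `(x, y) ↦ (a x + b y, b x - ā y)` whenever `|a|² + b² = 1`
(`HasGaussianCharFun.rotationInvariant`).

Equivalence of norms comes from a tail estimate rather than from hypercontractivity. Along `θ ↦ cos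
θ x + sin θ y` a Fourier-Hermite-Itô polynomial `F` of bidegree `(m, n)` is a trigonometric
polynomial of degree at most `m + n`, so its value at `θ = 0` is controlled by its values at
sufficiently many other angles. Hence, if `|F(x)| > C M`, then for one of `N` fixed pairs of
orthogonal directions both values of `|F|` exceed `M`. By rotation invariance these two values are
independent copies of `F`, so `μ(|F| > C M) ≤ N μ(|F| > M)²` (`RotationInvariant.exists_tail_le`).
Iteration gives tails of order `2^(-2^k)` at height `C^k M`, and these bound every moment by any
other (`exists_eLpNorm_le_of_tail`). The comparison passes to `L²`-closures
(`LpNormsEquivalent.topologicalClosure`). Closedness in `L^p` follows by completeness, and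
boundedness of the orthogonal projection for `p > 1` by duality
(`LpNormsEquivalent.exists_starProjection_bound`).

The Ornstein-Uhlenbeck operators are instances of `F ↦ ∫ F(a x + b y) μ(dy)`. Rotation invariance
and Jensen's inequality make them contractions of `L^p`, and rotation invariance also identifies the
`L²`-adjoint with the operator for `ā`. A recurrence for `J_{m,n}` and Gaussian integration by parts
give Mehler's formula in one variable; independence of the coordinates `φ_k` extends it to products
(`HasGaussianCharFun.mehler_fourierHermite`). The chaos of bidegree `(m, n)` is thus an eigenspace
for `a^m ā^n`, and chaoses of different bidegree are orthogonal because these eigenvalues differ for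
some `a`. All operator identities are proved on `L²` and carried to `L^p` by density of `L² ∩ L^p`.
-/

/-- The unitary map `(x, y) ↦ (a x + b y, b x - ā y)` of `E × E` (for `|a|² + b² = 1`). -/
def rotation (E : Type*) [NormedAddCommGroup E] [NormedSpace ℂ E] (a : ℂ) (b : ℝ) :
    E × E →L[ℂ] E × E :=
  ContinuousLinearMap.prod
    (a • ContinuousLinearMap.fst ℂ E E + (b : ℂ) • ContinuousLinearMap.snd ℂ E E)
    ((b : ℂ) • ContinuousLinearMap.fst ℂ E E - conj a • ContinuousLinearMap.snd ℂ E E)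

@[simp]
lemma rotation_apply {E : Type*} [NormedAddCommGroup E] [NormedSpace ℂ E] (a : ℂ) (b : ℝ)
    (z : E × E) :
    rotation E a b z = (a • z.1 + (b : ℂ) • z.2, (b : ℂ) • z.1 - conj a • z.2) := rfl

/-- `μ ⊗ μ` is invariant under the unitary maps `rotation E a b`. -/
def RotationInvariant {E : Type*} [NormedAddCommGroup E] [NormedSpace ℂ E] [MeasurableSpace E]
    (μ : Measure E) : Prop :=
  ∀ (a : ℂ) (b : ℝ), ‖a‖ ^ 2 + b ^ 2 = 1 →
    MeasurePreserving (rotation E a b) (μ.prod μ) (μ.prod μ)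

/-- The first component of a rotated pair of independent samples again has law `μ`. This is what
makes the Mehler integral independent of the chosen representative. -/
lemma RotationInvariant.measurePreserving_add {E : Type*} [NormedAddCommGroup E]
    [NormedSpace ℂ E] [MeasurableSpace E] {μ : Measure E} [IsProbabilityMeasure μ]
    (hμ : RotationInvariant μ) {a : ℂ} {b : ℝ} (hab : ‖a‖ ^ 2 + b ^ 2 = 1) :
    MeasurePreserving (fun z : E × E => a • z.1 + (b : ℂ) • z.2) (μ.prod μ) μ :=
  (measurePreserving_fst (μ := μ) (ν := μ)).comp (hμ a b hab)

end Rotation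

section Gaussian

set_option linter.unusedSectionVars false

variable {E H : Type*} [NormedAddCommGroup E] [NormedSpace ℝ E] [NormedSpace ℂ E]
  [IsScalarTower ℝ ℂ E]
  [NormedAddCommGroup H] [InnerProductSpace ℂ H] [NormedSpace ℝ H] [IsScalarTower ℝ ℂ H] {ι : H →L[ℂ] E}

/-- A real functional on `H` is the real part of a unique complex one, to which the complex Riesz
theorem applies. -/
lemma exists_riesz_re [CompleteSpace H] (ι : H →L[ℂ] E) (L : StrongDual ℝ E) :
    ∃ v : H, ∀ h, L (ι h) = (⟪v, h⟫_ℂ).re := by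
  set ℓ : StrongDual ℝ H := L.comp (ι.restrictScalars ℝ)
  refine ⟨(InnerProductSpace.toDual ℂ H).symm (ℓ.extendRCLike (𝕜 := ℂ)), fun h => ?_⟩
  rw [InnerProductSpace.toDual_symm_apply]
  exact (StrongDual.re_extendRCLike_apply (𝕜 := ℂ) ℓ h).symm

/-- Complexifying a real functional preserves its norm, so the variance in the characteristic
functional can be read off the complex Riesz vector. -/
lemma norm_comp_restrictScalars_eq [CompleteSpace H] {L : StrongDual ℝ E} {v : H}
    (hv : ∀ h, L (ι h) = (⟪v, h⟫_ℂ).re) : ‖L.comp (ι.restrictScalars ℝ)‖ = ‖v‖ := by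
  set ℓ : StrongDual ℝ H := L.comp (ι.restrictScalars ℝ)
  have h1 : ℓ.extendRCLike (𝕜 := ℂ) = InnerProductSpace.toDual ℂ H v := by
    ext h
    rw [StrongDual.extendRCLike_apply, InnerProductSpace.toDual_apply_apply]
    have e1 : ∀ h, ℓ h = (⟪v, h⟫_ℂ).re := hv
    rw [e1, e1, inner_smul_right]
    apply Complex.ext <;> simp
  rw [← StrongDual.norm_extendRCLike (𝕜 := ℂ) ℓ, h1, LinearIsometryEquiv.norm_map]

variable [MeasurableSpace E] {μ : Measure E}

/-- `μ` is the centered complex Gaussian measure with reproducing kernel Hilbert space `H ⊆ E`. -/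
def HasGaussianCharFun (ι : H →L[ℂ] E) (μ : Measure E) : Prop :=
  ∀ L : StrongDual ℝ E,
    charFunDual μ L = Complex.exp (-(‖L.comp (ι.restrictScalars ℝ)‖ : ℂ) ^ 2 / 2)

lemma HasGaussianCharFun.eq_of_riesz [CompleteSpace H] (hμ : HasGaussianCharFun ι μ)
    {L : StrongDual ℝ E} {v : H} (hv : ∀ h, L (ι h) = (⟪v, h⟫_ℂ).re) :
    charFunDual μ L = Complex.exp (-(‖v‖ : ℂ) ^ 2 / 2) := by
  rw [hμ, norm_comp_restrictScalars_eq hv]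

/-- The transpose of the rotation is an isometry of `H × H`: the two cross terms are opposite and
cancel. -/
lemma norm_sq_rotation {a : ℂ} {b : ℝ} (hab : ‖a‖ ^ 2 + b ^ 2 = 1) (v w : H) :
    ‖conj a • v + (b : ℂ) • w‖ ^ 2 + ‖(b : ℂ) • v - a • w‖ ^ 2 = ‖v‖ ^ 2 + ‖w‖ ^ 2 := by
  rw [norm_add_sq (𝕜 := ℂ), norm_sub_sq (𝕜 := ℂ)]
  simp only [inner_smul_left, inner_smul_right, norm_smul, RCLike.norm_conj,
    Complex.norm_real, Complex.conj_conj, Complex.conj_ofReal, mul_pow, Real.norm_eq_abs, sq_abs]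
  rw [show (b : ℂ) * (a * ⟪v, w⟫_ℂ) = a * (b * ⟪v, w⟫_ℂ) by ring]
  linear_combination (‖v‖ ^ 2 + ‖w‖ ^ 2) * hab

variable [BorelSpace E] [SecondCountableTopology E] [IsProbabilityMeasure μ]

/-- A real functional on `E × E` has a pair of Riesz vectors `(v, w)`. Composing it with the
rotation replaces them by `(ā v + b w, b v - a w)`, which has the same total squared norm, so the
characteristic functional is unchanged. -/
lemma HasGaussianCharFun.rotationInvariant [CompleteSpace E] [CompleteSpace H]
    (hμ : HasGaussianCharFun ι μ) : RotationInvariant μ := by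
  intro a b hab
  have hm : Measurable (rotation E a b) := (rotation E a b).continuous.measurable
  refine ⟨hm, ?_⟩
  have := Measure.isProbabilityMeasure_map (μ := μ.prod μ) hm.aemeasurable
  refine Measure.ext_of_charFunDual ?_
  ext L
  have hmap : charFunDual ((μ.prod μ).map (rotation E a b)) L =
      charFunDual (μ.prod μ) (L.comp ((rotation E a b).restrictScalars ℝ)) :=
    charFunDual_map (μ := μ.prod μ) ((rotation E a b).restrictScalars ℝ) L
  rw [hmap, charFunDual_prod, charFunDual_prod]
  obtain ⟨v, hv⟩ := exists_riesz_re ι (L.comp (.inl ℝ E E))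
  obtain ⟨w, hw⟩ := exists_riesz_re ι (L.comp (.inr ℝ E E))
  have hL : ∀ x y : E, L (x, y) = L (x, 0) + L (0, y) := fun x y => by
    rw [← map_add]; simp
  rw [hμ.eq_of_riesz hv, hμ.eq_of_riesz hw]
  simp only [ContinuousLinearMap.comp_apply, ContinuousLinearMap.inl_apply,
    ContinuousLinearMap.inr_apply] at hv hw
  rw [hμ.eq_of_riesz (v := conj a • v + (b : ℂ) • w),
    hμ.eq_of_riesz (v := (b : ℂ) • v - a • w), ← Complex.exp_add, ← Complex.exp_add]
  · congr 1
    have := congrArg (fun r : ℝ => (r : ℂ)) (norm_sq_rotation hab v w)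
    push_cast at this
    linear_combination (-1 / 2 : ℂ) * this
  · intro h
    simp only [ContinuousLinearMap.comp_apply, ContinuousLinearMap.inr_apply,
      ContinuousLinearMap.coe_restrictScalars', rotation_apply, smul_zero, zero_add, zero_sub]
    rw [hL, ← neg_smul, ← map_smul, ← map_smul, hv, hw]
    simp [inner_smul_right]
    ring
  · intro h
    simp only [ContinuousLinearMap.comp_apply, ContinuousLinearMap.inl_apply,
      ContinuousLinearMap.coe_restrictScalars', rotation_apply, smul_zero, add_zero, sub_zero]
    rw [hL, ← map_smul, ← map_smul, hv, hw]
    simp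
    ring

end Gaussian

section WienerSpaceInstances

variable (T : ℝ)

instance instSecondCountableTopologyWienerSpace : SecondCountableTopology (WienerSpace T) :=
  TopologicalSpace.Subtype.secondCountableTopology _

instance instCompleteSpaceWienerSpace : CompleteSpace (WienerSpace T) := by
  have h : IsClosed (pathSubmodule T : Set C(Set.Icc (0 : ℝ) T, ℂ)) := by
    change IsClosed {ω : C(Set.Icc (0 : ℝ) T, ℂ) | ∀ t : Set.Icc (0 : ℝ) T, (t : ℝ) = 0 → ω t = 0}
    simp only [Set.ofPred_forall]
    exact isClosed_iInter fun t => isClosed_iInter fun _ =>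
      isClosed_eq (continuous_eval_const t) continuous_const
  exact h.completeSpace_coe

end WienerSpaceInstances

lemma IsComplexWienerMeasure.rotationInvariant {T : ℝ} {μ : Measure (WienerSpace T)}
    (hμ : IsComplexWienerMeasure μ) : RotationInvariant μ := by
  have := hμ.isProbabilityMeasure
  refine HasGaussianCharFun.rotationInvariant (ι := cameronMartinEmbedding T) fun L => ?_
  exact hμ.charFunDual_eq L

/-! ### Equivalence of `L^p` norms from a self-improving tail estimate -/

section Tail

/-- The ratio of consecutive terms is `c · 2^(-2^k)`, which tends to `0`: doubly exponential decay
beats any geometric growth. -/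
lemma summable_pow_mul_inv_two_pow_two_pow (c : ℝ) (hc : 0 < c) :
    Summable fun k : ℕ => c ^ (k + 1) * (2⁻¹ : ℝ) ^ 2 ^ k := by
  refine summable_of_ratio_test_tendsto_lt_one (l := 0) one_pos
    (Filter.Eventually.of_forall fun k => by positivity) ?_
  have h1 : Filter.Tendsto (fun k : ℕ => c * (2⁻¹ : ℝ) ^ 2 ^ k) Filter.atTop (nhds (c * 0)) :=
    ((tendsto_pow_atTop_nhds_zero_of_lt_one (by norm_num) (by norm_num)).comp
      (tendsto_pow_atTop_atTop_of_one_lt one_lt_two)).const_mul c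
  rw [mul_zero] at h1
  refine h1.congr fun k => ?_
  rw [Real.norm_of_nonneg (by positivity), Real.norm_of_nonneg (by positivity),
    eq_div_iff (by positivity), pow_succ 2 k, mul_comm (2 ^ k) 2, pow_mul' _ 2 (2 ^ k),
    pow_succ c (k + 1)]
  ring

variable {α : Type*} [MeasurableSpace α] {μ : Measure α}

/-- The quantity `N μ(|f| > C^k M)` is at least squared, hence made smaller, by each step; carrying
the factor `N` along makes the induction close. -/
lemma tail_iterate {f : α → ℝ≥0} {C : ℝ≥0} {N : ℕ} (hN : N ≠ 0)
    (htail : ∀ M : ℝ≥0, μ {x | C * M < f x} ≤ N * μ {x | M < f x} ^ 2) {M : ℝ≥0}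
    (hM : N * μ {x | M < f x} ≤ 2⁻¹) (k : ℕ) :
    μ {x | C ^ k * M < f x} ≤ 2⁻¹ ^ 2 ^ k := by
  suffices h : N * μ {x | C ^ k * M < f x} ≤ 2⁻¹ ^ 2 ^ k by
    refine le_trans ?_ h
    refine le_mul_of_one_le_left' ?_
    exact_mod_cast Nat.one_le_iff_ne_zero.2 hN
  induction k with
  | zero => simpa using hM
  | succ k ih =>
    calc N * μ {x | C ^ (k + 1) * M < f x}
        ≤ N * (N * μ {x | C ^ k * M < f x} ^ 2) := by
          gcongr
          rw [pow_succ', mul_assoc]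
          exact htail _
      _ = (N * μ {x | C ^ k * M < f x}) ^ 2 := by ring
      _ ≤ (2⁻¹ ^ 2 ^ k) ^ 2 := by gcongr
      _ = 2⁻¹ ^ 2 ^ (k + 1) := by rw [← pow_mul, pow_succ]

/-- Layer decomposition along the geometric levels `C^k M`: the single layer containing `f x`
already bounds the left side. -/
lemma rpow_le_tsum_indicator {α : Type*} {C : ℝ≥0} (hC : 1 < C) {M : ℝ≥0} (hM : 0 < M) {p : ℝ} (hp : 0 < p)
    (f : α → ℝ≥0) (x : α) :
    (f x : ℝ≥0∞) ^ p ≤ (M : ℝ≥0∞) ^ p * (1 + ∑' k : ℕ, ((C : ℝ≥0∞) ^ p) ^ (k + 1) *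
      {x | C ^ k * M < f x}.indicator (fun _ => (1 : ℝ≥0∞)) x) := by
  rcases le_or_gt (f x) M with h | h
  · refine le_trans ?_ (le_mul_of_one_le_right' le_self_add)
    gcongr
  · have hex : ∃ k : ℕ, f x ≤ C ^ (k + 1) * M := by
      obtain ⟨k, hk⟩ := pow_unbounded_of_one_lt (f x / M) hC
      refine ⟨k, ?_⟩
      rw [div_lt_iff₀ hM] at hk
      exact hk.le.trans (by gcongr; exacts [hC.le, k.le_succ])
    classical
    set k := Nat.find hex with hk
    have hlt : C ^ k * M < f x := by
      rcases Nat.eq_zero_or_pos k with h0 | h0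
      · simpa [h0] using h
      · have := Nat.find_min hex (m := k - 1) (by omega)
        rwa [not_le, Nat.sub_add_cancel h0] at this
    have hle : f x ≤ C ^ (k + 1) * M := Nat.find_spec hex
    calc (f x : ℝ≥0∞) ^ p ≤ ((C : ℝ≥0∞) ^ (k + 1) * M) ^ p := by
          gcongr
          exact_mod_cast hle
      _ = (M : ℝ≥0∞) ^ p * (((C : ℝ≥0∞) ^ p) ^ (k + 1) *
            {x | C ^ k * M < f x}.indicator (fun _ => (1 : ℝ≥0∞)) x) := by
          rw [Set.indicator_of_mem (by exact hlt), mul_one, ENNReal.mul_rpow_of_nonneg _ _ hp.le,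
            ← ENNReal.rpow_natCast, ← ENNReal.rpow_natCast, ← ENNReal.rpow_mul, ← ENNReal.rpow_mul,
            mul_comm p, mul_comm]
      _ ≤ _ := by
          gcongr
          exact (ENNReal.le_tsum k).trans le_add_self

lemma exists_eLpNorm_le_of_tail [IsProbabilityMeasure μ] {C : ℝ≥0} (hC : 1 < C) {N : ℕ} (hN : N ≠ 0)
    {p q : ℝ≥0∞} (hp0 : p ≠ 0) (hp : p ≠ ∞) (hq0 : q ≠ 0) (hq : q ≠ ∞) :
    ∃ K : ℝ≥0, ∀ F : α → ℂ, AEStronglyMeasurable F μ →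
      (∀ M : ℝ≥0, μ {x | C * M < ‖F x‖₊} ≤ N * μ {x | M < ‖F x‖₊} ^ 2) →
      eLpNorm F p μ ≤ K * eLpNorm F q μ := by
  have hp' : 0 < p.toReal := ENNReal.toReal_pos hp0 hp
  have hq' : 0 < q.toReal := ENNReal.toReal_pos hq0 hq
  set S : ℝ≥0∞ := 1 + ∑' k : ℕ, ((C : ℝ≥0∞) ^ p.toReal) ^ (k + 1) * 2⁻¹ ^ 2 ^ k with hS
  have hS_top : S ≠ ∞ := by
    have hsum := summable_pow_mul_inv_two_pow_two_pow ((C : ℝ) ^ p.toReal) (by positivity)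
    refine ENNReal.add_ne_top.2 ⟨ENNReal.one_ne_top, ?_⟩
    refine (?_ : _ = _).trans_ne hsum.tsum_ofReal_ne_top
    congr 1
    ext k
    rw [ENNReal.ofReal_mul (by positivity), ENNReal.ofReal_pow (by positivity),
      ENNReal.ofReal_pow (by positivity), ← ENNReal.ofReal_rpow_of_pos (by positivity),
      ENNReal.ofReal_inv_of_pos two_pos, ENNReal.ofReal_coe_nnreal, ENNReal.ofReal_ofNat]
  have hc_top : (2 * N : ℝ≥0∞) ^ (1 / q.toReal) ≠ ∞ :=
    ENNReal.rpow_ne_top_of_nonneg (by positivity) (by finiteness)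
  have hc0 : (2 * N : ℝ≥0∞) ^ (1 / q.toReal) ≠ 0 := by
    simp [ENNReal.rpow_eq_zero_iff, hN, hq'.le]
  set K : ℝ≥0∞ := (2 * N : ℝ≥0∞) ^ (1 / q.toReal) * S ^ (1 / p.toReal) with hK
  have hK_top : K ≠ ∞ :=
    ENNReal.mul_ne_top hc_top (ENNReal.rpow_ne_top_of_nonneg (by positivity) hS_top)
  have hK0 : K ≠ 0 := by
    refine mul_ne_zero hc0 ?_
    simp [ENNReal.rpow_eq_zero_iff, hS, hp'.le]
  refine ⟨K.toNNReal, fun F hF htail => ?_⟩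
  rw [ENNReal.coe_toNNReal hK_top]
  rcases eq_or_ne (eLpNorm F q μ) ∞ with hQt | hQt
  · rw [hQt, ENNReal.mul_top hK0]; exact le_top
  rcases eq_or_ne (eLpNorm F q μ) 0 with hQ0 | hQ0
  · rw [eLpNorm_eq_zero_iff hF hq0] at hQ0
    rw [eLpNorm_congr_ae hQ0]
    simp
  set Q := eLpNorm F q μ with hQ
  -- With this height Chebyshev's inequality in `L^q` gives `N μ(|F| > M) ≤ 1/2`, which starts the
  -- iteration; `M` is a constant multiple of the `L^q` norm.
  set M : ℝ≥0 := ((2 * N : ℝ≥0∞) ^ (1 / q.toReal) * Q).toNNReal with hM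
  have hM_coe : (M : ℝ≥0∞) = (2 * N : ℝ≥0∞) ^ (1 / q.toReal) * Q :=
    ENNReal.coe_toNNReal (ENNReal.mul_ne_top hc_top hQt)
  have hM_ne : (M : ℝ≥0∞) ≠ 0 := hM_coe ▸ mul_ne_zero hc0 hQ0
  have hM_pos : 0 < M := pos_iff_ne_zero.2 (by exact_mod_cast hM_ne)
  have hcheb : N * μ {x | M < ‖F x‖₊} ≤ 2⁻¹ := by
    have h1 : μ {x | M < ‖F x‖₊} ≤ (M : ℝ≥0∞)⁻¹ ^ q.toReal * Q ^ q.toReal := by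
      refine le_trans (measure_mono fun x hx => ?_) (meas_ge_le_mul_pow_eLpNorm_enorm μ hq0 hq hF
        (ε := M) hM_ne (by simp))
      change (M : ℝ≥0∞) ≤ (‖F x‖₊ : ℝ≥0∞)
      exact_mod_cast (show M < ‖F x‖₊ from hx).le
    have hQq0 : Q ^ q.toReal ≠ 0 := by simp [ENNReal.rpow_eq_zero_iff, hQ0, hq'.le]
    have hQqt : Q ^ q.toReal ≠ ∞ := ENNReal.rpow_ne_top_of_nonneg hq'.le hQt
    have h2 : (M : ℝ≥0∞)⁻¹ ^ q.toReal * Q ^ q.toReal = (2 * N : ℝ≥0∞)⁻¹ := by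
      rw [ENNReal.inv_rpow, hM_coe, ENNReal.mul_rpow_of_nonneg _ _ hq'.le, ← ENNReal.rpow_mul,
        one_div_mul_cancel hq'.ne', ENNReal.rpow_one, ENNReal.mul_inv (.inr hQqt) (.inr hQq0),
        mul_assoc, ENNReal.inv_mul_cancel hQq0 hQqt, mul_one]
    calc N * μ {x | M < ‖F x‖₊} ≤ N * (2 * N : ℝ≥0∞)⁻¹ := by
          gcongr
          exact h1.trans_eq h2
      _ = 2⁻¹ := by
          rw [ENNReal.mul_inv (by simp) (by simp), mul_left_comm,
            ENNReal.mul_inv_cancel (by simpa using hN) (by simp), mul_one]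
  have hint : ∫⁻ x, ‖F x‖ₑ ^ p.toReal ∂μ ≤ (M : ℝ≥0∞) ^ p.toReal * S := by
    have hms : ∀ k : ℕ, NullMeasurableSet {x | C ^ k * M < ‖F x‖₊} μ := fun k =>
      nullMeasurableSet_lt aemeasurable_const hF.aemeasurable.nnnorm
    calc ∫⁻ x, ‖F x‖ₑ ^ p.toReal ∂μ
        ≤ ∫⁻ x, (M : ℝ≥0∞) ^ p.toReal * (1 + ∑' k : ℕ, ((C : ℝ≥0∞) ^ p.toReal) ^ (k + 1) *
            {x | C ^ k * M < ‖F x‖₊}.indicator (fun _ => (1 : ℝ≥0∞)) x) ∂μ :=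
          lintegral_mono fun x => rpow_le_tsum_indicator hC hM_pos hp' (fun x => ‖F x‖₊) x
      _ = (M : ℝ≥0∞) ^ p.toReal * (1 + ∑' k : ℕ, ((C : ℝ≥0∞) ^ p.toReal) ^ (k + 1) *
            μ {x | C ^ k * M < ‖F x‖₊}) := by
          have hMt : (M : ℝ≥0∞) ^ p.toReal ≠ ∞ := by finiteness
          have hCt : ∀ k : ℕ, ((C : ℝ≥0∞) ^ p.toReal) ^ (k + 1) ≠ ∞ := fun k => by finiteness
          rw [lintegral_const_mul' _ _ hMt, lintegral_add_left measurable_const, lintegral_tsum]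
          · simp only [lintegral_const, measure_univ, mul_one]
            congr 3
            ext k
            rw [lintegral_const_mul' _ _ (hCt k), lintegral_indicator_const₀ (hms k), one_mul]
          · exact fun k => (aemeasurable_const.indicator₀ (hms k)).const_mul _
      _ ≤ (M : ℝ≥0∞) ^ p.toReal * S := by
          gcongr
          rw [hS]
          gcongr with k
          exact tail_iterate (f := fun x => ‖F x‖₊) hN htail hcheb k
  rw [eLpNorm_eq_lintegral_rpow_enorm_toReal hp0 hp]
  calc (∫⁻ x, ‖F x‖ₑ ^ p.toReal ∂μ) ^ (1 / p.toReal)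
      ≤ ((M : ℝ≥0∞) ^ p.toReal * S) ^ (1 / p.toReal) := by gcongr
    _ = K * Q := by
        rw [ENNReal.mul_rpow_of_nonneg _ _ (by positivity), ← ENNReal.rpow_mul,
          mul_one_div_cancel hp'.ne', ENNReal.rpow_one, hM_coe, hK]
        ring

end Tail

/-! ### Functions which are trigonometric polynomials on circles -/

section TrigDegree

open Polynomial

/-- A bound for a polynomial at `1` which only needs one good node in each of sufficiently many
pairs of orthogonal directions. -/
lemma exists_orthogonal_nodes (D : ℕ) : ∃ (N : ℕ) (θ : Fin N → ℝ) (C : ℝ≥0), N ≠ 0 ∧ 1 < C ∧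
    ∀ p : ℂ[X], p.natDegree ≤ D → ∀ M : ℝ≥0,
      (∀ j, ‖p.eval (Complex.exp (θ j * Complex.I))‖₊ ≤ M ∨
        ‖p.eval (Complex.exp ((θ j - Real.pi / 2 : ℝ) * Complex.I))‖₊ ≤ M) →
      ‖p.eval 1‖₊ ≤ C * M := by
  classical
  -- The nodes lie strictly inside `(0, π/2)`, so their shifts by `-π/2` lie in `(-π/2, 0)`.
  -- Whichever angle is picked from each pair, the resulting `D + 1` points of the circle are
  -- distinct.
  set θ : Fin (D + 1) → ℝ := fun j => Real.pi / 2 * ((j + 1) / (D + 2)) with hθ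
  have hpi := Real.pi_pos
  have hθ0 : ∀ j, 0 < θ j := fun j => by positivity
  have hθ1 : ∀ j, θ j < Real.pi / 2 := fun j => by
    refine mul_lt_of_lt_one_right (by positivity) ?_
    rw [div_lt_one (by positivity)]
    have : ((j : ℕ) : ℝ) < (D + 1 : ℕ) := by exact_mod_cast j.2
    push_cast at this
    linarith
  have hθinj : Function.Injective θ := fun i j hij => by
    have h := mul_left_cancel₀ (by positivity) hij
    rw [div_left_inj' (by positivity), add_left_inj] at h
    exact Fin.ext (by exact_mod_cast h)
  set v : (Fin (D + 1) → Bool) → Fin (D + 1) → ℂ := fun σ j =>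
    Complex.exp ((if σ j then θ j else θ j - Real.pi / 2 : ℝ) * Complex.I) with hv
  have hvinj : ∀ σ, Set.InjOn (v σ) (Finset.univ : Finset (Fin (D + 1))) := fun σ i _ j _ hij => by
    have := hθ0 i; have := hθ1 i; have := hθ0 j; have := hθ1 j
    have h := congrArg Complex.arg hij
    simp only [hv] at h
    rw [Complex.arg_exp_mul_I, Complex.arg_exp_mul_I, (toIocMod_eq_self _).2,
      (toIocMod_eq_self _).2] at h
    · apply hθinj
      split_ifs at h <;> linarith
    · constructor <;> split_ifs <;> linarith
    · constructor <;> split_ifs <;> linarith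
  set B : (Fin (D + 1) → Bool) → ℝ≥0 := fun σ =>
    ∑ j, ‖(Lagrange.basis Finset.univ (v σ) j).eval 1‖₊ with hB
  -- Summing the Lagrange constants over all selections `σ` gives a bound that does not depend on
  -- the selection; the summand `2` only ensures `1 < C`.
  refine ⟨D + 1, θ, 2 + ∑ σ, B σ, by omega, ?_, fun p hp M hM => ?_⟩
  · exact lt_of_lt_of_le one_lt_two le_self_add
  have hσ : ∀ j, ∃ s : Bool, ‖p.eval (Complex.exp ((if s then θ j else θ j - Real.pi / 2 : ℝ) *
      Complex.I))‖₊ ≤ M := fun j => by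
    rcases hM j with h | h
    · exact ⟨true, by simpa using h⟩
    · exact ⟨false, by simpa using h⟩
  choose σ hσ using hσ
  have hdeg : p.degree < (Finset.univ : Finset (Fin (D + 1))).card := by
    rw [Finset.card_univ, Fintype.card_fin]
    exact lt_of_le_of_lt p.degree_le_natDegree (by exact_mod_cast Nat.lt_succ_of_le hp)
  rw [Lagrange.eq_interpolate (hvinj σ) hdeg, Lagrange.interpolate_apply, eval_finsetSum]
  calc ‖∑ j, (C (p.eval (v σ j)) * Lagrange.basis Finset.univ (v σ) j).eval 1‖₊
      ≤ ∑ j, ‖(C (p.eval (v σ j)) * Lagrange.basis Finset.univ (v σ) j).eval 1‖₊ :=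
        nnnorm_sum_le _ _
    _ ≤ ∑ j, M * ‖(Lagrange.basis Finset.univ (v σ) j).eval 1‖₊ := by
        gcongr with j
        rw [eval_mul, eval_C, nnnorm_mul]
        gcongr
        exact hσ j
    _ = B σ * M := by rw [← Finset.mul_sum, mul_comm]
    _ ≤ (2 + ∑ σ, B σ) * M := by
        gcongr
        exact (Finset.single_le_sum (fun _ _ => zero_le) (Finset.mem_univ σ)).trans le_add_self

variable {E : Type*} [NormedAddCommGroup E] [NormedSpace ℂ E]

/-- `θ ↦ F(cos θ x + sin θ y)` is, for all `x` and `y`, a trigonometric polynomial of degree at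
most `d`. -/
def HasTrigDegree (d : ℕ) (F : E → ℂ) : Prop :=
  ∀ x y : E, ∃ p : ℂ[X], p.natDegree ≤ 2 * d ∧ ∀ θ : ℝ,
    Complex.exp (θ * Complex.I) ^ d * F ((Real.cos θ : ℂ) • x + (Real.sin θ : ℂ) • y) =
      p.eval (Complex.exp (θ * Complex.I))

lemma HasTrigDegree.add {d : ℕ} {F G : E → ℂ} (hF : HasTrigDegree d F) (hG : HasTrigDegree d G) :
    HasTrigDegree d (F + G) := fun x y => by
  obtain ⟨p, hp, hp'⟩ := hF x y
  obtain ⟨q, hq, hq'⟩ := hG x y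
  refine ⟨p + q, (natDegree_add_le _ _).trans (max_le hp hq), fun θ => ?_⟩
  rw [eval_add, ← hp', ← hq', Pi.add_apply, mul_add]

lemma HasTrigDegree.mul {d e : ℕ} {F G : E → ℂ} (hF : HasTrigDegree d F) (hG : HasTrigDegree e G) :
    HasTrigDegree (d + e) (F * G) := fun x y => by
  obtain ⟨p, hp, hp'⟩ := hF x y
  obtain ⟨q, hq, hq'⟩ := hG x y
  refine ⟨p * q, natDegree_mul_le.trans (by omega), fun θ => ?_⟩
  rw [eval_mul, ← hp', ← hq', Pi.mul_apply, pow_add]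
  ring

lemma hasTrigDegree_const (d : ℕ) (c : ℂ) : HasTrigDegree d (fun _ : E => c) := fun _ _ =>
  ⟨C c * X ^ d, (natDegree_C_mul_X_pow_le c d).trans (by omega), fun θ => by
    rw [eval_mul, eval_C, eval_pow, eval_X, mul_comm]⟩

lemma HasTrigDegree.const_mul {d : ℕ} {F : E → ℂ} (c : ℂ) (hF : HasTrigDegree d F) :
    HasTrigDegree d (fun x => c * F x) := by
  have h := (hasTrigDegree_const (E := E) 0 c).mul hF
  rw [Nat.zero_add] at h
  exact h

lemma HasTrigDegree.mono {d e : ℕ} (hde : d ≤ e) {F : E → ℂ} (hF : HasTrigDegree d F) :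
    HasTrigDegree e F := by
  have h := hF.mul (hasTrigDegree_const (E := E) (e - d) 1)
  rw [Nat.add_sub_cancel' hde] at h
  simpa [Pi.mul_def] using h

lemma HasTrigDegree.prod {ι : Type*} (s : Finset ι) {d : ι → ℕ} {F : ι → E → ℂ}
    (hF : ∀ i ∈ s, HasTrigDegree (d i) (F i)) :
    HasTrigDegree (∑ i ∈ s, d i) (fun x => ∏ i ∈ s, F i x) := by
  classical
  induction s using Finset.induction_on with
  | empty => simpa using hasTrigDegree_const (E := E) 0 1
  | insert i s hi ih =>
    simp only [Finset.sum_insert hi, Finset.prod_insert hi]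
    exact (hF i (Finset.mem_insert_self _ _)).mul
      (ih fun j hj => hF j (Finset.mem_insert_of_mem hj))

/-- Euler's formulas for cosine and sine give the two coefficients. Only real coefficients occur, so
conjugate-linear functions are covered as well. -/
lemma hasTrigDegree_of_real_linear {F : E → ℂ}
    (hF : ∀ (a b : ℝ) (x y : E), F ((a : ℂ) • x + (b : ℂ) • y) = a * F x + b * F y) :
    HasTrigDegree 1 F := fun x y => by
  refine ⟨C ((F x - Complex.I * F y) / 2) * X ^ 2 + C ((F x + Complex.I * F y) / 2),
    by compute_degree!, fun θ => ?_⟩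
  rw [hF]
  have h1 : Complex.exp (θ * Complex.I) = Complex.cos θ + Complex.sin θ * Complex.I :=
    Complex.exp_mul_I _
  have h2 := Complex.cos_sq_add_sin_sq θ
  push_cast
  simp only [eval_add, eval_mul, eval_C, eval_pow, eval_X, h1]
  set c := Complex.cos θ
  set s := Complex.sin θ
  linear_combination (F x + F y * Complex.I) / 2 * h2 +
    (s ^ 2 * (F y * Complex.I - F x) / 2 + c * s * F y) * Complex.I_sq

lemma hasTrigDegree_dual (φ : StrongDual ℂ E) : HasTrigDegree 1 (fun x => φ x) :=
  hasTrigDegree_of_real_linear fun a b x y => by simp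

lemma hasTrigDegree_conj_dual (φ : StrongDual ℂ E) :
    HasTrigDegree 1 (fun x => conj (φ x)) :=
  hasTrigDegree_of_real_linear fun a b x y => by simp

variable [MeasurableSpace E] [BorelSpace E] [SecondCountableTopology E] {μ : Measure E}
  [IsProbabilityMeasure μ]

lemma RotationInvariant.exists_tail_le (hμ : RotationInvariant μ) (d : ℕ) :
    ∃ (N : ℕ) (C : ℝ≥0), N ≠ 0 ∧ 1 < C ∧ ∀ F : E → ℂ, Continuous F → HasTrigDegree d F →
      ∀ M : ℝ≥0, μ {x | C * M < ‖F x‖₊} ≤ N * μ {x | M < ‖F x‖₊} ^ 2 := by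
  obtain ⟨N, θ, C, hN, hC, h⟩ := exists_orthogonal_nodes (2 * d)
  refine ⟨N, C, hN, hC, fun F hF hFd M => ?_⟩
  have hms : ∀ R : ℝ≥0, MeasurableSet {x | R < ‖F x‖₊} := fun R =>
    measurableSet_lt measurable_const hF.measurable.nnnorm
  set A := {x | M < ‖F x‖₊}
  have hab : ∀ j, ‖(Real.cos (θ j) : ℂ)‖ ^ 2 + Real.sin (θ j) ^ 2 = 1 := fun j => by
    rw [Complex.norm_real, Real.norm_eq_abs, sq_abs, Real.cos_sq_add_sin_sq]
  -- For every `y` and every `x` in the tail, some node `θ j` must have both `cos θ x + sin θ y` and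
  -- `sin θ x - cos θ y` in `A`; otherwise each pair has a good node and interpolation bounds `F x`
  -- by `C M`.
  have hsub : {x | C * M < ‖F x‖₊} ×ˢ Set.univ ⊆
      ⋃ j, rotation E (Real.cos (θ j)) (Real.sin (θ j)) ⁻¹' (A ×ˢ A) := by
    rintro ⟨x, y⟩ ⟨hx, -⟩
    by_contra hcon
    simp only [Set.mem_iUnion, Set.mem_preimage, not_exists, Set.mem_prod, not_and_or] at hcon
    obtain ⟨p, hp, hp'⟩ := hFd x y
    refine absurd (h p hp M fun j => ?_) (not_le.2 ?_)
    · have hn : ∀ t : ℝ, ‖p.eval (Complex.exp (t * Complex.I))‖₊ =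
          ‖F ((Real.cos t : ℂ) • x + (Real.sin t : ℂ) • y)‖₊ := fun t => by
        rw [← hp', nnnorm_mul, nnnorm_pow, show ‖Complex.exp (t * Complex.I)‖₊ = 1 from
          NNReal.coe_injective (Complex.norm_exp_ofReal_mul_I t), one_pow, one_mul]
      rw [hn, hn, Real.cos_sub_pi_div_two, Real.sin_sub_pi_div_two]
      refine (hcon j).imp (fun hj => not_lt.1 hj) (fun hj => not_lt.1 ?_)
      rwa [rotation_apply, Complex.conj_ofReal, sub_eq_add_neg, ← neg_smul,
        ← Complex.ofReal_neg] at hj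
    · have := hp' 0
      simp only [Complex.ofReal_zero, zero_mul, Complex.exp_zero, one_pow, one_mul, Real.cos_zero,
        Complex.ofReal_one, one_smul, Real.sin_zero, zero_smul, add_zero] at this
      rw [← this]
      exact hx
  calc μ {x | C * M < ‖F x‖₊} = (μ.prod μ) ({x | C * M < ‖F x‖₊} ×ˢ Set.univ) := by
        rw [Measure.prod_prod, measure_univ, mul_one]
    _ ≤ ∑ j, (μ.prod μ) (rotation E (Real.cos (θ j)) (Real.sin (θ j)) ⁻¹' (A ×ˢ A)) :=
        (measure_mono hsub).trans (measure_iUnion_fintype_le _ _)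
    _ = N * μ A ^ 2 := by
        have hj : ∀ j, (μ.prod μ) (rotation E (Real.cos (θ j)) (Real.sin (θ j)) ⁻¹' (A ×ˢ A)) =
            μ A ^ 2 := fun j => by
          rw [(hμ _ _ (hab j)).measure_preimage ((hms M).prod (hms M)).nullMeasurableSet,
            Measure.prod_prod, sq]
        rw [Finset.sum_congr rfl fun j _ => hj j]
        simp

/-- On functions of bounded trigonometric degree all `L^p` norms, `0 < p < ∞`, are equivalent. -/
lemma RotationInvariant.exists_eLpNorm_le (hμ : RotationInvariant μ) (d : ℕ) {p q : ℝ≥0∞}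
    (hp0 : p ≠ 0) (hp : p ≠ ∞) (hq0 : q ≠ 0) (hq : q ≠ ∞) :
    ∃ K : ℝ≥0, ∀ F : E → ℂ, Continuous F → HasTrigDegree d F →
      eLpNorm F p μ ≤ K * eLpNorm F q μ := by
  obtain ⟨N, C, hN, hC, h⟩ := hμ.exists_tail_le d
  obtain ⟨K, hK⟩ := exists_eLpNorm_le_of_tail (μ := μ) hC hN hp0 hp hq0 hq
  exact ⟨K, fun F hF hFd => hK F hF.aestronglyMeasurable (h F hF hFd)⟩

end TrigDegree

/-! ### Subspaces of `L²` on which all `L^p` norms are equivalent -/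

section NormEquiv

open Filter
open scoped Topology

variable {α : Type*} [MeasurableSpace α] {μ : Measure α}

/-- All `L^p` norms, `1 ≤ p < ∞`, are equivalent on `V`. -/
def LpNormsEquivalent (V : Submodule ℂ (Lp ℂ 2 μ)) : Prop :=
  ∀ p q : ℝ≥0∞, 1 ≤ p → p ≠ ∞ → 1 ≤ q → q ≠ ∞ →
    ∃ K : ℝ≥0, ∀ F ∈ V, eLpNorm F p μ ≤ K * eLpNorm F q μ

lemma LpNormsEquivalent.memLp {V : Submodule ℂ (Lp ℂ 2 μ)} (hV : LpNormsEquivalent V) {p : ℝ≥0∞}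
    (hp1 : 1 ≤ p) (hp : p ≠ ∞) {F : Lp ℂ 2 μ} (hF : F ∈ V) : MemLp F p μ := by
  obtain ⟨K, hK⟩ := hV p 2 hp1 hp one_le_two ENNReal.ofNat_ne_top
  exact ⟨Lp.aestronglyMeasurable F,
    (hK F hF).trans_lt (ENNReal.mul_lt_top ENNReal.coe_lt_top (Lp.eLpNorm_lt_top F))⟩

/-- As `p` may exceed `2`, `L²`-limits are not `L^p`-limits. Lower semicontinuity of the `L^p` norm
under convergence in measure suffices; the factor `2` comes from `‖G n‖ < 2 ‖F‖` eventually, for `F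
≠ 0`. -/
lemma eLpNorm_le_of_mem_closure {V : Submodule ℂ (Lp ℂ 2 μ)} {p : ℝ≥0∞} {K : ℝ≥0}
    (hK : ∀ F ∈ V, eLpNorm F p μ ≤ K * eLpNorm F 2 μ) {F : Lp ℂ 2 μ}
    (hF : F ∈ V.topologicalClosure) : eLpNorm F p μ ≤ (K * 2 : ℝ≥0) * eLpNorm F 2 μ := by
  rcases eq_or_ne F 0 with rfl | h0
  · rw [eLpNorm_congr_ae (Lp.coeFn_zero ℂ 2 μ)]
    simp
  obtain ⟨G, hGV, hG⟩ := mem_closure_iff_seq_limit.1 hF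
  refine eLpNorm_le_of_tendstoInMeasure ?_ (tendstoInMeasure_of_tendsto_Lp hG)
    fun n => Lp.aestronglyMeasurable _
  have h : ∀ᶠ n in atTop, ‖G n‖ < 2 * ‖F‖ :=
    hG.norm.eventually_lt_const (by linarith [norm_pos_iff.2 h0])
  filter_upwards [h] with n hn
  refine (hK _ (hGV n)).trans ?_
  rw [ENNReal.coe_mul, mul_assoc]
  gcongr
  rw [← Lp.enorm_def, ← Lp.enorm_def, ← ofReal_norm, ← ofReal_norm]
  refine (ENNReal.ofReal_le_ofReal hn.le).trans_eq ?_
  rw [ENNReal.ofReal_mul zero_le_two]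
  simp

lemma eLpNorm_le_eLpNorm_sub_add {f g : α → ℂ} (hf : AEStronglyMeasurable f μ)
    (hg : AEStronglyMeasurable g μ) {p : ℝ≥0∞} (hp : 1 ≤ p) :
    eLpNorm g p μ ≤ eLpNorm (f - g) p μ + eLpNorm f p μ := by
  have h := eLpNorm_add_le (hg.sub hf) hf hp
  rwa [sub_add_cancel, eLpNorm_sub_comm] at h

/-- For `q ≤ 2` on a probability space, `L²`-convergence controls the `L^q` norms too, so the
inequality passes to the limit by two triangle inequalities. -/
lemma eLpNorm_two_le_of_mem_closure [IsProbabilityMeasure μ] {V : Submodule ℂ (Lp ℂ 2 μ)}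
    {q : ℝ≥0∞} (hq1 : 1 ≤ q) (hq2 : q ≤ 2) {K : ℝ≥0}
    (hK : ∀ F ∈ V, eLpNorm F 2 μ ≤ K * eLpNorm F q μ) {F : Lp ℂ 2 μ}
    (hF : F ∈ V.topologicalClosure) : eLpNorm F 2 μ ≤ K * eLpNorm F q μ := by
  obtain ⟨G, hGV, hG⟩ := mem_closure_iff_seq_limit.1 hF
  have hδ : Tendsto (fun n => eLpNorm (⇑(G n) - ⇑F) 2 μ) atTop (𝓝 0) :=
    (Lp.tendsto_Lp_iff_tendsto_eLpNorm' G F).1 hG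
  have hlim : Tendsto (fun n => eLpNorm (⇑(G n) - ⇑F) 2 μ +
      K * (eLpNorm F q μ + eLpNorm (⇑(G n) - ⇑F) 2 μ)) atTop
      (𝓝 (0 + K * (eLpNorm F q μ + 0))) :=
    hδ.add (ENNReal.Tendsto.const_mul (tendsto_const_nhds.add hδ) (.inr ENNReal.coe_ne_top))
  rw [zero_add, add_zero] at hlim
  refine ge_of_tendsto' hlim fun n => (eLpNorm_le_eLpNorm_sub_add (Lp.aestronglyMeasurable (G n))
    (Lp.aestronglyMeasurable F) one_le_two).trans ?_
  gcongr
  refine (hK _ (hGV n)).trans ?_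
  gcongr
  refine (eLpNorm_le_eLpNorm_sub_add (Lp.aestronglyMeasurable F)
    (Lp.aestronglyMeasurable (G n)) hq1).trans ?_
  rw [add_comm, eLpNorm_sub_comm]
  gcongr
  exact eLpNorm_le_eLpNorm_of_exponent_le hq2
    ((Lp.aestronglyMeasurable (G n)).sub (Lp.aestronglyMeasurable F))

lemma LpNormsEquivalent.topologicalClosure [IsProbabilityMeasure μ] {V : Submodule ℂ (Lp ℂ 2 μ)}
    (hV : LpNormsEquivalent V) : LpNormsEquivalent V.topologicalClosure := by
  intro p q hp1 hp hq1 hq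
  obtain ⟨K, hK⟩ := hV p 2 hp1 hp one_le_two ENNReal.ofNat_ne_top
  obtain ⟨L, hL⟩ : ∃ L : ℝ≥0, ∀ F ∈ V.topologicalClosure,
      eLpNorm F 2 μ ≤ L * eLpNorm F q μ := by
    rcases le_total q 2 with h | h
    · obtain ⟨L, hL⟩ := hV 2 q one_le_two ENNReal.ofNat_ne_top hq1 hq
      exact ⟨L, fun F hF => eLpNorm_two_le_of_mem_closure hq1 h hL hF⟩
    · refine ⟨1, fun F _ => ?_⟩
      rw [ENNReal.coe_one, one_mul]
      exact eLpNorm_le_eLpNorm_of_exponent_le h (Lp.aestronglyMeasurable F)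
  refine ⟨K * 2 * L, fun F hF => (eLpNorm_le_of_mem_closure hK hF).trans ?_⟩
  rw [ENNReal.coe_mul (K * 2), mul_assoc]
  gcongr
  exact hL F hF

/-- The inclusion into `L^p` of a subspace `V` of `L²` with equivalent norms. -/
lemma LpNormsEquivalent.exists_inclusion {V : Submodule ℂ (Lp ℂ 2 μ)} (hV : LpNormsEquivalent V)
    (p : ℝ≥0∞) [hp1 : Fact (1 ≤ p)] (hp : p ≠ ∞) :
    ∃ (ι : V →L[ℂ] Lp ℂ p μ) (K : ℝ≥0), AntilipschitzWith K ι ∧ ∀ F, ι F =ᵐ[μ] F := by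
  obtain ⟨K, hK⟩ := hV p 2 hp1.out hp one_le_two ENNReal.ofNat_ne_top
  obtain ⟨L, hL⟩ := hV 2 p one_le_two ENNReal.ofNat_ne_top hp1.out hp
  have hmem : ∀ F : V, MemLp (F : Lp ℂ 2 μ) p μ := fun F => hV.memLp hp1.out hp F.2
  set ι₀ : V →ₗ[ℂ] Lp ℂ p μ :=
    { toFun := fun F => (hmem F).toLp _
      map_add' := fun F G => by
        rw [← MemLp.toLp_add]
        exact MemLp.toLp_congr _ _ (Lp.coeFn_add _ _)
      map_smul' := fun c F => by
        rw [RingHom.id_apply, ← MemLp.toLp_const_smul]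
        exact MemLp.toLp_congr _ _ (Lp.coeFn_smul _ _) }
  have hnorm : ∀ F : V, ‖ι₀ F‖ₑ = eLpNorm (F : Lp ℂ 2 μ) p μ := fun F => Lp.enorm_toLp (hmem F)
  refine ⟨ι₀.mkContinuous K fun F => ?_, L, ?_, fun F => MemLp.coeFn_toLp (hmem F)⟩
  · rw [← ENNReal.ofReal_le_ofReal_iff (by positivity), ofReal_norm, hnorm,
      ENNReal.ofReal_mul (by positivity), ofReal_norm, ENNReal.ofReal_coe_nnreal]
    exact (hK F F.2).trans_eq (by rw [← Lp.enorm_def]; rfl)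
  · refine AddMonoidHomClass.antilipschitz_of_bound _ fun F => ?_
    rw [← ENNReal.ofReal_le_ofReal_iff (by positivity),
      ENNReal.ofReal_mul (by positivity), ofReal_norm, ofReal_norm, ENNReal.ofReal_coe_nnreal]
    have h := hL F F.2
    rw [← hnorm, ← Lp.enorm_def] at h
    exact h

/-- The set is the range of the inclusion of the complete space `V`, which is bounded below in
`L^p`. -/
lemma LpNormsEquivalent.isClosed_setOf {V : Submodule ℂ (Lp ℂ 2 μ)} (hV : LpNormsEquivalent V)
    (hVc : IsClosed (V : Set (Lp ℂ 2 μ))) (p : ℝ≥0∞) [Fact (1 ≤ p)] (hp : p ≠ ∞) :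
    IsClosed {G : Lp ℂ p μ | ∃ F ∈ V, G =ᵐ[μ] F} := by
  obtain ⟨ι, K, hι, hιF⟩ := hV.exists_inclusion p hp
  have : CompleteSpace V := hVc.completeSpace_coe
  convert hι.isClosed_range ι.uniformContinuous using 1
  ext G
  constructor
  · rintro ⟨F, hF, hGF⟩
    exact ⟨⟨F, hF⟩, Lp.ext ((hιF _).trans hGF.symm)⟩
  · rintro ⟨F, rfl⟩
    exact ⟨F, F.2, hιF F⟩

end NormEquiv

/-! ### Extension of operators from `L² ∩ L^p` to `L^p` -/

section Extension

variable {α : Type*} [MeasurableSpace α] {μ : Measure α}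

/-- `L² ∩ L^p` as a subspace of `L^p`. -/
def memL2Submodule (μ : Measure α) (p : ℝ≥0∞) : Submodule ℂ (Lp ℂ p μ) where
  carrier := {G | MemLp G 2 μ}
  add_mem' hF hG := (hF.add hG).ae_eq (Lp.coeFn_add _ _).symm
  zero_mem' := (MemLp.zero' (p := 2)).ae_eq (Lp.coeFn_zero ℂ p μ).symm
  smul_mem' c _ hF := (hF.const_smul c).ae_eq (Lp.coeFn_smul _ _).symm

lemma dense_memL2Submodule [IsFiniteMeasure μ] (p : ℝ≥0∞) [Fact (1 ≤ p)] (hp : p ≠ ∞) :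
    Dense (memL2Submodule μ p : Set (Lp ℂ p μ)) := by
  refine (Lp.simpleFunc.dense (E := ℂ) (μ := μ) hp).mono fun G hG => ?_
  have h := Lp.simpleFunc.toSimpleFunc_eq_toFun (⟨G, hG⟩ : Lp.simpleFunc ℂ p μ)
  exact (SimpleFunc.memLp_of_isFiniteMeasure _ 2 μ).ae_eq h

/-- Two bounded operators on `L^p` which agree on `L² ∩ L^p` are equal. -/
lemma clm_ext_of_memL2 [IsFiniteMeasure μ] {p : ℝ≥0∞} [Fact (1 ≤ p)] (hp : p ≠ ∞)
    {A B : Lp ℂ p μ →L[ℂ] Lp ℂ p μ}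
    (h : ∀ (F : Lp ℂ 2 μ) (hF : MemLp F p μ), A (hF.toLp F) = B (hF.toLp F)) : A = B := by
  refine ContinuousLinearMap.coeFn_injective (Continuous.ext_on (dense_memL2Submodule p hp)
    A.continuous B.continuous fun G hG => ?_)
  have hG' : MemLp G 2 μ := hG
  have hF : MemLp (hG'.toLp G) p μ := (Lp.memLp G).ae_eq hG'.coeFn_toLp.symm
  have : hF.toLp _ = G := Lp.ext (hF.coeFn_toLp.trans hG'.coeFn_toLp)
  have h1 := h _ hF
  rwa [this] at h1

/-- Extension by continuity from the dense subspace `L² ∩ L^p`, realised inside `L^p` with a second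
linear map `e₂` back into `L²`. -/
lemma exists_extension_memL2 [IsFiniteMeasure μ] {p : ℝ≥0∞} [Fact (1 ≤ p)] (hp : p ≠ ∞)
    (A : Lp ℂ 2 μ →L[ℂ] Lp ℂ 2 μ) (K : ℝ≥0)
    (hA : ∀ F : Lp ℂ 2 μ, MemLp F p μ → eLpNorm (A F) p μ ≤ K * eLpNorm F p μ) :
    ∃ B : Lp ℂ p μ →L[ℂ] Lp ℂ p μ, ∀ (F : Lp ℂ 2 μ) (hF : MemLp F p μ),
      B (hF.toLp F) =ᵐ[μ] A F := by
  set D := memL2Submodule μ p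
  have hD : ∀ G : D, MemLp (G : Lp ℂ p μ) 2 μ := fun G => G.2
  set e₂ : D →ₗ[ℂ] Lp ℂ 2 μ :=
    { toFun := fun G => (hD G).toLp _
      map_add' := fun F G => by
        rw [← MemLp.toLp_add]
        exact MemLp.toLp_congr _ _ (Lp.coeFn_add _ _)
      map_smul' := fun c F => by
        rw [RingHom.id_apply, ← MemLp.toLp_const_smul]
        exact MemLp.toLp_congr _ _ (Lp.coeFn_smul _ _) } with he₂
  have he₂' : ∀ G : D, e₂ G =ᵐ[μ] (G : Lp ℂ p μ) := fun G => (hD G).coeFn_toLp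
  have hbound : ∀ G : D, eLpNorm (A (e₂ G)) p μ ≤ K * eLpNorm (G : Lp ℂ p μ) p μ := fun G => by
    rw [← eLpNorm_congr_ae (he₂' G)]
    exact hA _ ((Lp.memLp (G : Lp ℂ p μ)).ae_eq (he₂' G).symm)
  have hmem : ∀ G : D, MemLp (A (e₂ G)) p μ := fun G => ⟨Lp.aestronglyMeasurable _,
    (hbound G).trans_lt (ENNReal.mul_lt_top ENNReal.coe_lt_top (Lp.eLpNorm_lt_top _))⟩
  set f : D →ₗ[ℂ] Lp ℂ p μ :=
    { toFun := fun G => (hmem G).toLp _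
      map_add' := fun F G => by
        rw [← MemLp.toLp_add]
        refine MemLp.toLp_congr _ _ ?_
        rw [map_add, map_add]
        exact Lp.coeFn_add _ _
      map_smul' := fun c F => by
        rw [RingHom.id_apply, ← MemLp.toLp_const_smul]
        refine MemLp.toLp_congr _ _ ?_
        rw [map_smul, map_smul]
        exact Lp.coeFn_smul _ _ }
  have hdense : DenseRange D.subtype := by
    simpa using! (dense_memL2Submodule (μ := μ) p hp).denseRange_val
  have hfnorm : ∀ G : D, ‖f G‖ ≤ K * ‖D.subtype G‖ := fun G => by
    rw [← ENNReal.ofReal_le_ofReal_iff (by positivity), ofReal_norm,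
      ENNReal.ofReal_mul (by positivity), ofReal_norm, ENNReal.ofReal_coe_nnreal]
    have h := hbound G
    rw [← Lp.enorm_toLp (hmem G), ← Lp.enorm_def] at h
    exact h
  refine ⟨f.extendOfNorm D.subtype, fun F hF => ?_⟩
  have hF2 : MemLp (hF.toLp F) 2 μ := (Lp.memLp F).ae_eq hF.coeFn_toLp.symm
  have h1 := LinearMap.extendOfNorm_eq (f := f) hdense ⟨K, hfnorm⟩ ⟨hF.toLp F, hF2⟩
  rw [Submodule.subtype_apply] at h1
  rw [h1]
  refine (MemLp.coeFn_toLp (hmem _)).trans ?_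
  rw [show e₂ ⟨hF.toLp F, hF2⟩ = F from Lp.ext ((he₂' _).trans hF.coeFn_toLp)]

end Extension

/-! ### Boundedness of orthogonal projections in `L^p` -/

section Projection

variable {α : Type*} [MeasurableSpace α] {μ : Measure α}

lemma exists_holderConjugate {p : ℝ≥0∞} (hp1 : 1 < p) :
    ∃ q, q ≠ ∞ ∧ ENNReal.HolderConjugate q p := by
  have h : p⁻¹ < 1 := ENNReal.inv_lt_one.2 hp1
  refine ⟨(1 - p⁻¹)⁻¹, ENNReal.inv_ne_top.2 (tsub_pos_of_lt h).ne', ?_⟩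
  rw [ENNReal.holderConjugate_iff, inv_inv, tsub_add_cancel_of_le h.le]

/-- Duality: with `P` the projection of `F` and `q` conjugate to `p`, `‖P‖₂² = Re ⟪P, F⟫ ≤ ‖P‖_q
‖F‖_p ≤ L ‖P‖₂ ‖F‖_p`. Cancelling `‖P‖₂` bounds it by `‖F‖_p`, and `‖P‖_p ≤ K ‖P‖₂` finishes. Here
`p > 1` makes `q` finite. -/
lemma LpNormsEquivalent.exists_starProjection_bound {V : Submodule ℂ (Lp ℂ 2 μ)}
    [V.HasOrthogonalProjection] (hV : LpNormsEquivalent V) {p : ℝ≥0∞} (hp1 : 1 < p) (hp : p ≠ ∞) :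
    ∃ K : ℝ≥0, ∀ F : Lp ℂ 2 μ,
      eLpNorm (V.starProjection F) p μ ≤ K * eLpNorm F p μ := by
  obtain ⟨q, hq, hpq⟩ := exists_holderConjugate hp1
  have hq1 : 1 ≤ q := ENNReal.HolderConjugate.one_le q p
  obtain ⟨K, hK⟩ := hV p 2 hp1.le hp one_le_two ENNReal.ofNat_ne_top
  obtain ⟨L, hL⟩ := hV q 2 hq1 hq one_le_two ENNReal.ofNat_ne_top
  refine ⟨K * L, fun F => ?_⟩
  set P := V.starProjection F
  have hP : P ∈ V := V.starProjection_apply_mem F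
  have hL2 : ‖P‖ₑ ≤ L * eLpNorm F p μ := by
    rcases eq_or_ne ‖P‖ₑ 0 with h0 | h0
    · rw [h0]; exact zero_le
    have hPt : ‖P‖ₑ ≠ ∞ := enorm_ne_top
    have h1 : ‖P‖ₑ * ‖P‖ₑ ≤ ‖P‖ₑ * (L * eLpNorm F p μ) := by
      calc ‖P‖ₑ * ‖P‖ₑ = ENNReal.ofReal (‖P‖ ^ 2) := by
            rw [ENNReal.ofReal_pow (norm_nonneg _), ofReal_norm, sq]
        _ = ENNReal.ofReal (RCLike.re ⟪P, F⟫_ℂ) := by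
            rw [V.re_inner_starProjection_eq_normSq]
            rfl
        _ ≤ ‖⟪P, F⟫_ℂ‖ₑ := by
            rw [← ofReal_norm]
            exact ENNReal.ofReal_le_ofReal (RCLike.re_le_norm _)
        _ ≤ eLpNorm (star (P : α → ℂ) • (F : α → ℂ)) 1 μ := by
            rw [L2.inner_def, eLpNorm_one_eq_lintegral_enorm]
            refine (enorm_integral_le_lintegral_enorm _).trans_eq ?_
            refine lintegral_congr fun x => ?_
            rw [RCLike.inner_apply']
            rfl
        _ ≤ eLpNorm (star (P : α → ℂ)) q μ * eLpNorm F p μ :=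
            eLpNorm_smul_le_mul_eLpNorm (Lp.aestronglyMeasurable F)
              (Lp.aestronglyMeasurable P).star
        _ ≤ (L * ‖P‖ₑ) * eLpNorm F p μ := by
            gcongr
            rw [eLpNorm_star]
            exact (hL P hP).trans_eq (by rw [← Lp.enorm_def])
        _ = ‖P‖ₑ * (L * eLpNorm F p μ) := by ring
    exact (ENNReal.mul_le_mul_iff_right h0 hPt).1 h1
  calc eLpNorm P p μ ≤ K * ‖P‖ₑ := (hK P hP).trans_eq (by rw [← Lp.enorm_def])
    _ ≤ K * (L * eLpNorm F p μ) := by gcongr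
    _ = _ := by rw [ENNReal.coe_mul, mul_assoc]

lemma LpNormsEquivalent.exists_starProjection_extension [IsFiniteMeasure μ]
    {V : Submodule ℂ (Lp ℂ 2 μ)}
    [V.HasOrthogonalProjection] (hV : LpNormsEquivalent V) {p : ℝ≥0∞} [Fact (1 ≤ p)] (hp1 : 1 < p)
    (hp : p ≠ ∞) : ∃ B : Lp ℂ p μ →L[ℂ] Lp ℂ p μ, ∀ (F : Lp ℂ 2 μ) (hF : MemLp F p μ),
      B (hF.toLp F) =ᵐ[μ] V.starProjection F := by
  obtain ⟨K, hK⟩ := hV.exists_starProjection_bound hp1 hp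
  exact exists_extension_memL2 hp _ K fun F _ => hK F

end Projection

/-! ### The Ornstein-Uhlenbeck operators on `L^p` -/

section Mehler

open Filter
open scoped Topology

variable {E : Type*} [NormedAddCommGroup E] [NormedSpace ℂ E] [MeasurableSpace E]

/-- `F ↦ ∫ F(a x + b y) dμ(y)`. -/
def mehler (μ : Measure E) (a : ℂ) (b : ℝ) (F : E → ℂ) (x : E) : ℂ :=
  ∫ y, F (a • x + (b : ℂ) • y) ∂μ

variable {μ : Measure E} [IsProbabilityMeasure μ] {a : ℂ} {b : ℝ}

lemma mehler_congr_ae (hμ : RotationInvariant μ) (hab : ‖a‖ ^ 2 + b ^ 2 = 1) {F G : E → ℂ}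
    (hFG : F =ᵐ[μ] G) : mehler μ a b F =ᵐ[μ] mehler μ a b G := by
  have h := (hμ.measurePreserving_add hab).quasiMeasurePreserving.ae_eq hFG
  filter_upwards [Measure.ae_ae_of_ae_prod h] with x hx
  exact integral_congr_ae hx

lemma aestronglyMeasurable_comp_add (hμ : RotationInvariant μ) (hab : ‖a‖ ^ 2 + b ^ 2 = 1)
    {F : E → ℂ} (hF : AEStronglyMeasurable F μ) :
    AEStronglyMeasurable (fun z : E × E => F (a • z.1 + (b : ℂ) • z.2)) (μ.prod μ) :=
  hF.comp_measurePreserving (hμ.measurePreserving_add hab)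

lemma aestronglyMeasurable_mehler (hμ : RotationInvariant μ) (hab : ‖a‖ ^ 2 + b ^ 2 = 1)
    {F : E → ℂ} (hF : AEStronglyMeasurable F μ) : AEStronglyMeasurable (mehler μ a b F) μ :=
  (aestronglyMeasurable_comp_add hμ hab hF).integral_prod_right'

lemma lintegral_enorm_rpow_le {α : Type*} [MeasurableSpace α] {ν : Measure α}
    [IsProbabilityMeasure ν] {p : ℝ} (hp : 1 ≤ p) {f : α → ℂ} (hf : AEStronglyMeasurable f ν) :
    (∫⁻ y, ‖f y‖ₑ ∂ν) ^ p ≤ ∫⁻ y, ‖f y‖ₑ ^ p ∂ν := by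
  have hp0 : 0 < p := by linarith
  have h := eLpNorm_le_eLpNorm_of_exponent_le (p := 1) (q := ENNReal.ofReal p)
    (by simpa using hp) hf
  rw [eLpNorm_one_eq_lintegral_enorm, eLpNorm_eq_lintegral_rpow_enorm_toReal
    (by simpa using hp0) ENNReal.ofReal_ne_top, ENNReal.toReal_ofReal hp0.le] at h
  calc _ ≤ ((∫⁻ y, ‖f y‖ₑ ^ p ∂ν) ^ (1 / p)) ^ p := by gcongr
    _ = _ := by rw [← ENNReal.rpow_mul, one_div_mul_cancel hp0.ne', ENNReal.rpow_one]

/-- The Ornstein-Uhlenbeck operators are contractions of `L^p`. -/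
lemma eLpNorm_mehler_le (hμ : RotationInvariant μ) (hab : ‖a‖ ^ 2 + b ^ 2 = 1) {p : ℝ≥0∞}
    (hp1 : 1 ≤ p) (hp : p ≠ ∞) {F : E → ℂ} (hF : AEStronglyMeasurable F μ) :
    eLpNorm (mehler μ a b F) p μ ≤ eLpNorm F p μ := by
  have hp0 : p ≠ 0 := (one_pos.trans_le hp1).ne'
  have hp1' : 1 ≤ p.toReal := by
    rw [← ENNReal.toReal_one]
    exact ENNReal.toReal_mono hp hp1
  have hm := aestronglyMeasurable_comp_add hμ hab hF
  -- The norm of `F` is computed on the product space from `F(a x + b y)`; Fubini then leaves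
  -- Jensen's inequality in `y` for fixed `x`.
  rw [← eLpNorm_comp_measurePreserving hF (hμ.measurePreserving_add hab),
    eLpNorm_eq_lintegral_rpow_enorm_toReal hp0 hp, eLpNorm_eq_lintegral_rpow_enorm_toReal hp0 hp]
  gcongr ?_ ^ _
  rw [lintegral_prod _ (by exact (hm.enorm.pow_const _))]
  refine lintegral_mono_ae ?_
  filter_upwards [hm.prodMk_left] with x hx
  calc ‖mehler μ a b F x‖ₑ ^ p.toReal
      ≤ (∫⁻ y, ‖F (a • x + (b : ℂ) • y)‖ₑ ∂μ) ^ p.toReal := by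
        gcongr
        exact enorm_integral_le_lintegral_enorm _
    _ ≤ _ := lintegral_enorm_rpow_le hp1' hx

lemma MemLp.mehler (hμ : RotationInvariant μ) (hab : ‖a‖ ^ 2 + b ^ 2 = 1) {p : ℝ≥0∞}
    (hp1 : 1 ≤ p) (hp : p ≠ ∞) {F : E → ℂ} (hF : MemLp F p μ) :
    MemLp (mehler μ a b F) p μ :=
  ⟨aestronglyMeasurable_mehler hμ hab hF.1, (eLpNorm_mehler_le hμ hab hp1 hp hF.1).trans_lt hF.2⟩

lemma ae_integrable_comp_add (hμ : RotationInvariant μ) (hab : ‖a‖ ^ 2 + b ^ 2 = 1)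
    {F : E → ℂ} (hF : Integrable F μ) :
    ∀ᵐ x ∂μ, Integrable (fun y => F (a • x + (b : ℂ) • y)) μ :=
  ((hμ.measurePreserving_add hab).integrable_comp_of_integrable hF).prod_right_ae

/-- The Ornstein-Uhlenbeck operator as a bounded operator on `L^p`. -/
lemma exists_mehler_clm (hμ : RotationInvariant μ) (hab : ‖a‖ ^ 2 + b ^ 2 = 1) (p : ℝ≥0∞)
    [hp1 : Fact (1 ≤ p)] (hp : p ≠ ∞) : ∃ S : Lp ℂ p μ →L[ℂ] Lp ℂ p μ,
      ∀ (F : E → ℂ) (hF : MemLp F p μ), S (hF.toLp F) =ᵐ[μ] mehler μ a b F := by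
  have hmem : ∀ F : Lp ℂ p μ, MemLp (mehler μ a b F) p μ := fun F =>
    MemLp.mehler hμ hab hp1.out hp (Lp.memLp F)
  have hint : ∀ F : Lp ℂ p μ, Integrable F μ := fun F => (Lp.memLp F).integrable hp1.out
  set S₀ : Lp ℂ p μ →ₗ[ℂ] Lp ℂ p μ :=
    { toFun := fun F => (hmem F).toLp _
      map_add' := fun F G => by
        rw [← MemLp.toLp_add]
        refine MemLp.toLp_congr _ _ ((mehler_congr_ae hμ hab (Lp.coeFn_add F G)).trans ?_)
        filter_upwards [ae_integrable_comp_add hμ hab (hint F),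
          ae_integrable_comp_add hμ hab (hint G)] with x hx hy
        exact integral_add hx hy
      map_smul' := fun c F => by
        rw [RingHom.id_apply, ← MemLp.toLp_const_smul]
        refine MemLp.toLp_congr _ _ ((mehler_congr_ae hμ hab (Lp.coeFn_smul c F)).trans ?_)
        exact Eventually.of_forall fun x => integral_smul c _ }
  refine ⟨S₀.mkContinuous 1 fun F => ?_, fun F hF => ?_⟩
  · rw [one_mul, ← ENNReal.ofReal_le_ofReal_iff (by positivity), ofReal_norm, ofReal_norm]
    have h := eLpNorm_mehler_le hμ hab hp1.out hp (Lp.aestronglyMeasurable F)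
    rw [← Lp.enorm_toLp (hmem F), ← Lp.enorm_def] at h
    exact h
  · exact ((hmem _).coeFn_toLp).trans (mehler_congr_ae hμ hab hF.coeFn_toLp)

/-- The adjoint of the Ornstein-Uhlenbeck operator of parameter `a` is that of parameter `ā`. -/
lemma integral_mehler_mul (hμ : RotationInvariant μ) (hab : ‖a‖ ^ 2 + b ^ 2 = 1) {F G : E → ℂ}
    (hF : MemLp F 2 μ) (hG : MemLp G 2 μ) :
    ∫ x, mehler μ a b F x * G x ∂μ = ∫ x, F x * mehler μ (conj a) b G x ∂μ := by
  have hab' : ‖conj a‖ ^ 2 + b ^ 2 = 1 := by rwa [RCLike.norm_conj]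
  have h1 : Integrable (fun z : E × E => F (a • z.1 + (b : ℂ) • z.2) * G z.1) (μ.prod μ) :=
    (hF.comp_measurePreserving (hμ.measurePreserving_add hab)).integrable_mul
      (hG.comp_measurePreserving measurePreserving_fst)
  have h2 : Integrable (fun z : E × E => F z.1 * G (conj a • z.1 + (b : ℂ) • z.2)) (μ.prod μ) :=
    (hF.comp_measurePreserving measurePreserving_fst).integrable_mul
      (hG.comp_measurePreserving (hμ.measurePreserving_add hab'))
  -- The rotation for `(ā, b)` inverts the one for `(a, b)`; this identity is its first component
  -- and moves the affine argument from `F` to `G`.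
  have hinv : ∀ z : E × E, conj a • (rotation E a b z).1 + (b : ℂ) • (rotation E a b z).2 = z.1 :=
    fun z => by
      have h : conj a * a + (b : ℂ) * b = 1 := by
        rw [Complex.conj_mul']
        exact_mod_cast (by rw [← sq b]; exact hab : ‖a‖ ^ 2 + b * b = 1)
      simp only [rotation_apply, smul_add, smul_sub, smul_smul]
      rw [mul_comm (conj a) (b : ℂ), add_add_sub_cancel, ← add_smul, h, one_smul]
  calc ∫ x, mehler μ a b F x * G x ∂μ
      = ∫ z, F (a • z.1 + (b : ℂ) • z.2) * G z.1 ∂(μ.prod μ) := by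
        rw [integral_prod _ h1]
        exact integral_congr_ae (Eventually.of_forall fun x => (integral_mul_const (G x) _).symm)
    _ = ∫ z, F (rotation E a b z).1 *
          G (conj a • (rotation E a b z).1 + (b : ℂ) • (rotation E a b z).2) ∂(μ.prod μ) := by
        refine integral_congr_ae (Eventually.of_forall fun z => ?_)
        dsimp only
        rw [hinv]
        rfl
    _ = ∫ z, F z.1 * G (conj a • z.1 + (b : ℂ) • z.2) ∂(μ.prod μ) := by
        have hmp := hμ a b hab
        have h3 := h2.aestronglyMeasurable
        rw [← hmp.map_eq] at h3
        conv_rhs => rw [← hmp.map_eq, integral_map hmp.measurable.aemeasurable h3]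
    _ = ∫ x, F x * mehler μ (conj a) b G x ∂μ := by
        rw [integral_prod _ h2]
        exact integral_congr_ae (Eventually.of_forall fun x => integral_const_mul (F x) _)

end Mehler

/-! ### Recurrences for the Hermite-Laguerre-Itô polynomials -/

section HermiteLaguerreIto

/-- `f` is real differentiable at `z` with `∂f/∂z = u` and `∂f/∂z̄ = v`. -/
def HasWirtingerAt (f : ℂ → ℂ) (u v z : ℂ) : Prop :=
  HasFDerivAt f (u • (ContinuousLinearMap.id ℝ ℂ) + v • (Complex.conjCLE : ℂ →L[ℝ] ℂ)) z

variable {f g : ℂ → ℂ} {u v u' v' z : ℂ}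

lemma HasWirtingerAt.wirtinger_eq (h : HasWirtingerAt f u v z) : wirtinger f z = u := by
  rw [wirtinger, HasFDerivAt.fderiv h]
  simp
  linear_combination (v - u) / 2 * Complex.I_sq

lemma HasWirtingerAt.wirtingerBar_eq (h : HasWirtingerAt f u v z) : wirtingerBar f z = v := by
  rw [wirtingerBar, HasFDerivAt.fderiv h]
  simp
  linear_combination (u - v) / 2 * Complex.I_sq

lemma hasWirtingerAt_const (c z : ℂ) : HasWirtingerAt (fun _ => c) 0 0 z := by
  refine (hasFDerivAt_const (𝕜 := ℝ) c z).congr_fderiv ?_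
  ext; simp

lemma hasWirtingerAt_id (z : ℂ) : HasWirtingerAt (fun w => w) 1 0 z := by
  refine (hasFDerivAt_id (𝕜 := ℝ) z).congr_fderiv ?_
  ext
  simp

lemma hasWirtingerAt_conj (z : ℂ) : HasWirtingerAt (fun w => conj w) 0 1 z := by
  refine (Complex.conjCLE.hasFDerivAt (x := z)).congr_fderiv ?_
  ext
  simp

lemma HasWirtingerAt.mul (hf : HasWirtingerAt f u v z) (hg : HasWirtingerAt g u' v' z) :
    HasWirtingerAt (fun w => f w * g w) (f z * u' + u * g z) (f z * v' + v * g z) z := by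
  refine (HasFDerivAt.mul hf hg).congr_fderiv ?_
  ext
  simp
  ring

lemma HasWirtingerAt.sub (hf : HasWirtingerAt f u v z) (hg : HasWirtingerAt g u' v' z) :
    HasWirtingerAt (fun w => f w - g w) (u - u') (v - v') z := by
  refine (HasFDerivAt.sub hf hg).congr_fderiv ?_
  ext
  simp
  ring

lemma hasWirtingerAt_conj_pow (n : ℕ) (z : ℂ) :
    HasWirtingerAt (fun w => conj w ^ n) 0 (n * conj z ^ (n - 1)) z := by
  induction n with
  | zero => simpa using hasWirtingerAt_const 1 z
  | succ n ih =>
    have h := (hasWirtingerAt_conj z).mul ih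
    convert h using 1
    · ext w
      rw [pow_succ']
    · ring
    · rcases n with _ | n
      · simp
      · push_cast [Nat.add_sub_cancel]
        ring

lemma iterate_creationBar_one (n : ℕ) :
    (creationBar^[n] fun _ => 1) = fun z => (1 / 2) ^ n * conj z ^ n := by
  induction n with
  | zero => simp
  | succ n ih =>
    rw [Function.iterate_succ_apply', ih]
    ext z
    have h := (hasWirtingerAt_const ((1 / 2) ^ n) z).mul (hasWirtingerAt_conj_pow n z)
    rw [creationBar, h.wirtinger_eq]
    ring

lemma hermiteLaguerreIto_zero_left (n : ℕ) (z : ℂ) : hermiteLaguerreIto 0 n z = conj z ^ n := by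
  rw [hermiteLaguerreIto, Function.iterate_zero_apply, iterate_creationBar_one, ← mul_assoc,
    zero_add, ← mul_pow]
  norm_num

lemma hermiteLaguerreIto_succ_eq_creation (m n : ℕ) :
    hermiteLaguerreIto (m + 1) n = fun z =>
      -(2 * wirtingerBar (hermiteLaguerreIto m n) z) + z * hermiteLaguerreIto m n z := by
  ext z
  have hw : wirtingerBar (hermiteLaguerreIto m n) z =
      2 ^ (m + n) * wirtingerBar (creation^[m] (creationBar^[n] fun _ => 1)) z := by
    have hf : hermiteLaguerreIto m n =
        (2 ^ (m + n) : ℂ) • (creation^[m] (creationBar^[n] fun _ => 1)) := rfl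
    -- Constant scalars pass through `fderiv` without differentiability, so the recurrence is
    -- available before smoothness of these functions is known.
    rw [wirtingerBar, wirtingerBar, hf, fderiv_const_smul_field]
    simp only [Pi.smul_apply, _root_.smul_apply, smul_eq_mul]
    ring
  rw [hw, hermiteLaguerreIto, hermiteLaguerreIto, Function.iterate_succ_apply', creation]
  ring

/-- The lowering rule `∂J_{m,n}/∂z̄ = n J_{m,n-1}` propagates through the creation recurrence in
`m`. The other derivative stays unspecified, since only real differentiability is needed from it.
For `n = 0` the factor `n` makes the truncated `n - 1` harmless. -/
lemma exists_hasWirtingerAt_hermiteLaguerreIto (m n : ℕ) (z : ℂ) :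
    ∃ u, HasWirtingerAt (hermiteLaguerreIto m n) u (n * hermiteLaguerreIto m (n - 1) z) z := by
  induction m generalizing n z with
  | zero =>
    refine ⟨0, ?_⟩
    rw [hermiteLaguerreIto_zero_left]
    exact (hasWirtingerAt_conj_pow n z).congr_of_eventuallyEq
      (Filter.Eventually.of_forall fun w => hermiteLaguerreIto_zero_left n w)
  | succ m ih =>
    have hrec : ∀ k : ℕ, hermiteLaguerreIto (m + 1) k = fun w =>
        w * hermiteLaguerreIto m k w - 2 * k * hermiteLaguerreIto m (k - 1) w := fun k => by
      rw [hermiteLaguerreIto_succ_eq_creation]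
      ext w
      obtain ⟨u, hu⟩ := ih k w
      rw [hu.wirtingerBar_eq]
      ring
    obtain ⟨u, hu⟩ := ih n z
    obtain ⟨u', hu'⟩ := ih (n - 1) z
    rw [hrec n, hrec (n - 1)]
    have h := ((hasWirtingerAt_id z).mul hu).sub ((hasWirtingerAt_const (2 * n) z).mul hu')
    have e : z * (n * hermiteLaguerreIto m (n - 1) z) + 0 * hermiteLaguerreIto m n z -
        (2 * n * ((n - 1 : ℕ) * hermiteLaguerreIto m (n - 1 - 1) z) +
          0 * hermiteLaguerreIto m (n - 1) z) =
        n * (z * hermiteLaguerreIto m (n - 1) z -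
          2 * (n - 1 : ℕ) * hermiteLaguerreIto m (n - 1 - 1) z) := by ring
    rw [e] at h
    exact ⟨_, h⟩

/-- Together with `J_{0,n} = z̄^n` this determines all the polynomials; from here on it replaces the
differential definition. -/
lemma hermiteLaguerreIto_succ_left (m n : ℕ) (z : ℂ) : hermiteLaguerreIto (m + 1) n z =
    z * hermiteLaguerreIto m n z - 2 * n * hermiteLaguerreIto m (n - 1) z := by
  obtain ⟨u, hu⟩ := exists_hasWirtingerAt_hermiteLaguerreIto m n z
  rw [hermiteLaguerreIto_succ_eq_creation]
  simp only
  rw [hu.wirtingerBar_eq]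
  ring

lemma continuous_hermiteLaguerreIto (m n : ℕ) : Continuous (hermiteLaguerreIto m n) := by
  refine continuous_iff_continuousAt.2 fun z => ?_
  obtain ⟨u, hu⟩ := exists_hasWirtingerAt_hermiteLaguerreIto m n z
  exact HasFDerivAt.continuousAt hu

lemma hasTrigDegree_hermiteLaguerreIto {E : Type*} [NormedAddCommGroup E] [NormedSpace ℂ E]
    (φ : StrongDual ℂ E) (m n : ℕ) :
    HasTrigDegree (m + n) fun x => hermiteLaguerreIto m n (φ x) := by
  induction m generalizing n with
  | zero =>
    simp only [hermiteLaguerreIto_zero_left]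
    have h := HasTrigDegree.prod (Finset.range n) fun _ _ => hasTrigDegree_conj_dual φ
    simpa using h
  | succ m ih =>
    simp only [hermiteLaguerreIto_succ_left, sub_eq_add_neg, ← neg_mul]
    have h1 : HasTrigDegree (m + 1 + n) fun x => φ x * hermiteLaguerreIto m n (φ x) :=
      ((hasTrigDegree_dual φ).mul (ih n)).mono (by omega)
    exact h1.add (((ih (n - 1)).const_mul _).mono (by omega))

end HermiteLaguerreIto

/-! ### Moments of the standard complex Gaussian measure -/

section Moments

/-- `ν` is the standard complex Gaussian measure on `ℂ` (with `∫ |z|² dν = 2`). -/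
def IsStandardComplexGaussian (ν : Measure ℂ) : Prop :=
  HasGaussianCharFun (ContinuousLinearMap.id ℂ ℂ) ν

variable {ν : Measure ℂ} [IsProbabilityMeasure ν]

lemma IsStandardComplexGaussian.map_eq_gaussianReal (hν : IsStandardComplexGaussian ν)
    {L : StrongDual ℝ ℂ} (hL : ‖L‖ = 1) : ν.map L = gaussianReal 0 1 := by
  have := Measure.isProbabilityMeasure_map (μ := ν) L.continuous.measurable.aemeasurable
  refine Measure.ext_of_charFun ?_
  ext t
  rw [charFun_map_eq_charFunDual_smul, hν, charFun_gaussianReal]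
  have h : ‖(t • L).comp ((ContinuousLinearMap.id ℂ ℂ).restrictScalars ℝ)‖ = |t| := by
    have : (t • L).comp ((ContinuousLinearMap.id ℂ ℂ).restrictScalars ℝ) = t • L := by
      ext
      simp
    rw [this, norm_smul, hL, mul_one, Real.norm_eq_abs]
  rw [h]
  congr 1
  have : ((|t| : ℝ) : ℂ) ^ 2 = (t : ℂ) ^ 2 := by exact_mod_cast sq_abs t
  rw [this]
  push_cast
  ring

lemma IsStandardComplexGaussian.memLp_dual (hν : IsStandardComplexGaussian ν)
    {L : StrongDual ℝ ℂ} (hL : ‖L‖ = 1) (p : ℝ≥0) : MemLp L p ν := by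
  have h := memLp_id_gaussianReal (μ := 0) (v := 1) p
  rw [← hν.map_eq_gaussianReal hL] at h
  exact h.comp_of_map L.continuous.measurable.aemeasurable

lemma IsStandardComplexGaussian.integral_dual_sq (hν : IsStandardComplexGaussian ν)
    {L : StrongDual ℝ ℂ} (hL : ‖L‖ = 1) : ∫ w, L w ^ 2 ∂ν = 1 := by
  have h : ∫ x, x ^ 2 ∂(gaussianReal 0 1) = 1 := by
    have := variance_fun_id_gaussianReal (μ := 0) (v := 1)
    rwa [variance_of_integral_eq_zero (by fun_prop) integral_id_gaussianReal] at this
  rw [← hν.map_eq_gaussianReal hL,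
    integral_map L.continuous.measurable.aemeasurable (by fun_prop)] at h
  exact h

lemma IsStandardComplexGaussian.memLp_id (hν : IsStandardComplexGaussian ν) (p : ℝ≥0) :
    MemLp (fun w : ℂ => w) p ν := by
  have h1 := (hν.memLp_dual Complex.reCLM_norm p).norm.add (hν.memLp_dual Complex.imCLM_norm p).norm
  refine h1.mono continuous_id.aestronglyMeasurable (Filter.Eventually.of_forall fun w => ?_)
  refine (Complex.norm_le_abs_re_add_abs_im w).trans ?_
  exact le_abs_self _

lemma IsStandardComplexGaussian.integrable_norm_pow (hν : IsStandardComplexGaussian ν) (n : ℕ) :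
    Integrable (fun w : ℂ => ‖w‖ ^ n) ν := by
  simpa using (hν.memLp_id n).integrable_norm_pow'

lemma IsStandardComplexGaussian.integrable_monomial (hν : IsStandardComplexGaussian ν) (m n : ℕ) :
    Integrable (fun w : ℂ => w ^ m * conj w ^ n) ν := by
  refine (hν.integrable_norm_pow (m + n)).mono' (by fun_prop)
    (Filter.Eventually.of_forall fun w => ?_)
  rw [norm_mul, norm_pow, norm_pow, RCLike.norm_conj, pow_add]

lemma IsStandardComplexGaussian.rotationInvariant (hν : IsStandardComplexGaussian ν) :
    RotationInvariant ν :=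
  HasGaussianCharFun.rotationInvariant hν

/-- The measure is invariant under multiplication by `exp(iπ/(m - n))`, which changes the sign of
the monomial. -/
lemma IsStandardComplexGaussian.integral_monomial_of_ne (hν : IsStandardComplexGaussian ν)
    {m n : ℕ} (hmn : m ≠ n) : ∫ w, w ^ m * conj w ^ n ∂ν = 0 := by
  set t : ℝ := Real.pi / ((m : ℝ) - n)
  have hne : (m : ℝ) - n ≠ 0 := sub_ne_zero.2 (by exact_mod_cast hmn)
  set c : ℂ := Complex.exp (t * Complex.I) with hc
  have hmp := hν.rotationInvariant.measurePreserving_add (a := c) (b := 0)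
    (by rw [hc, Complex.norm_exp_ofReal_mul_I]; norm_num)
  have hcc : c ^ m * conj c ^ n = -1 := by
    rw [hc, ← Complex.exp_conj, ← Complex.exp_nat_mul, ← Complex.exp_nat_mul, ← Complex.exp_add,
      ← Complex.exp_pi_mul_I]
    congr 1
    have : ((m : ℂ) - n) * t = Real.pi := by
      have h : ((m : ℝ) - n) * t = Real.pi := mul_div_cancel₀ Real.pi hne
      exact_mod_cast congrArg (fun x : ℝ => (x : ℂ)) h
    simp only [map_mul, Complex.conj_ofReal, Complex.conj_I]
    linear_combination Complex.I * this
  have h : ∫ w, w ^ m * conj w ^ n ∂ν = -∫ w, w ^ m * conj w ^ n ∂ν := by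
    conv_lhs => rw [← hmp.map_eq, integral_map hmp.measurable.aemeasurable (by fun_prop)]
    have e : ∀ x : ℂ × ℂ, (c • x.1 + ((0 : ℝ) : ℂ) • x.2) ^ m *
        conj (c • x.1 + ((0 : ℝ) : ℂ) • x.2) ^ n = -(x.1 ^ m * conj x.1 ^ n) := fun x => by
      rw [Complex.ofReal_zero, zero_smul, add_zero, smul_eq_mul, map_mul, mul_pow, mul_pow]
      linear_combination (x.1 ^ m * conj x.1 ^ n) * hcc
    simp only [e]
    rw [integral_fun_fst (μ := ν) (ν := ν) (fun w : ℂ => -(w ^ m * conj w ^ n)), probReal_univ,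
      one_smul, integral_neg]
  linear_combination h / 2

lemma IsStandardComplexGaussian.integral_normSq (hν : IsStandardComplexGaussian ν) :
    ∫ w : ℂ, w ^ 1 * conj w ^ 1 ∂ν = 2 := by
  have h : ∀ w : ℂ, w ^ 1 * conj w ^ 1 = ((Complex.reCLM w ^ 2 + Complex.imCLM w ^ 2 : ℝ) : ℂ) :=
    fun w => by
      rw [pow_one, pow_one, Complex.mul_conj, Complex.normSq_apply, sq, sq]
      rfl
  simp only [h]
  rw [integral_complex_ofReal, integral_add, hν.integral_dual_sq Complex.reCLM_norm,
    hν.integral_dual_sq Complex.imCLM_norm]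
  · norm_num
  · exact (hν.memLp_dual Complex.reCLM_norm 2).integrable_sq
  · exact (hν.memLp_dual Complex.imCLM_norm 2).integrable_sq

/-- For independent copies `w, w'` the variable `(w + w')/√2` has the same law. Expand both
binomials; only the diagonal terms survive, because unbalanced monomials integrate to zero. -/
lemma IsStandardComplexGaussian.two_pow_mul_integral_monomial (hν : IsStandardComplexGaussian ν)
    (n : ℕ) : 2 ^ n * ∫ w, w ^ n * conj w ^ n ∂ν = ∑ k ∈ Finset.range (n + 1),
      (n.choose k : ℂ) ^ 2 * (∫ w, w ^ k * conj w ^ k ∂ν) *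
        ∫ w, w ^ (n - k) * conj w ^ (n - k) ∂ν := by
  set r : ℝ := (√2)⁻¹ with hr
  have hr2 : r ^ 2 = 1 / 2 := by rw [hr, inv_pow, Real.sq_sqrt zero_le_two, one_div]
  have hmp := hν.rotationInvariant.measurePreserving_add (a := r) (b := r)
    (by rw [Complex.norm_real, Real.norm_eq_abs, sq_abs, hr2]; norm_num)
  have hrc : (2 : ℂ) ^ n * (r ^ n * r ^ n) = 1 := by
    rw [← mul_pow, ← mul_pow, ← sq]
    have : (2 : ℂ) * (r : ℂ) ^ 2 = 1 := by exact_mod_cast (by rw [hr2]; norm_num : 2 * r ^ 2 = 1)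
    rw [this, one_pow]
  set t : ℕ → ℕ → ℂ × ℂ → ℂ := fun i j z => ((n.choose i : ℂ) * n.choose j) *
    ((z.1 ^ i * conj z.1 ^ j) * (z.2 ^ (n - i) * conj z.2 ^ (n - j))) with ht
  have hexp : ∀ z : ℂ × ℂ, 2 ^ n * (((r : ℂ) • z.1 + (r : ℂ) • z.2) ^ n *
      conj ((r : ℂ) • z.1 + (r : ℂ) • z.2) ^ n) =
      ∑ i ∈ Finset.range (n + 1), ∑ j ∈ Finset.range (n + 1), t i j z := fun z => by
    rw [← smul_add, smul_eq_mul, map_mul, Complex.conj_ofReal, mul_pow, mul_pow, map_add]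
    calc 2 ^ n * ((r : ℂ) ^ n * (z.1 + z.2) ^ n * ((r : ℂ) ^ n * (conj z.1 + conj z.2) ^ n))
        = (2 ^ n * (r ^ n * r ^ n)) * ((z.1 + z.2) ^ n * (conj z.1 + conj z.2) ^ n) := by ring
      _ = _ := by
          rw [hrc, one_mul, add_pow, add_pow, Finset.sum_mul_sum]
          refine Finset.sum_congr rfl fun i _ => Finset.sum_congr rfl fun j _ => ?_
          rw [ht]
          ring
  have hint : ∀ i j, Integrable (t i j) (ν.prod ν) := fun i j =>
    ((hν.integrable_monomial i j).mul_prod (hν.integrable_monomial (n - i) (n - j))).const_mul _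
  have hval : ∀ i j, ∫ z, t i j z ∂(ν.prod ν) = ((n.choose i : ℂ) * n.choose j) *
      ((∫ w, w ^ i * conj w ^ j ∂ν) * ∫ w, w ^ (n - i) * conj w ^ (n - j) ∂ν) := fun i j => by
    rw [integral_const_mul, integral_prod_mul (fun w : ℂ => w ^ i * conj w ^ j)
      (fun w : ℂ => w ^ (n - i) * conj w ^ (n - j))]
  conv_lhs => rw [← hmp.map_eq, integral_map hmp.measurable.aemeasurable (by fun_prop),
    ← integral_const_mul]
  simp only [hexp]
  rw [integral_finsetSum _ fun i _ => integrable_finsetSum _ fun j _ => hint i j]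
  refine Finset.sum_congr rfl fun i hi => ?_
  rw [integral_finsetSum _ fun j _ => hint i j, Finset.sum_eq_single_of_mem i hi]
  · rw [hval]
    ring
  · intro j _ hji
    rw [hval, hν.integral_monomial_of_ne hji.symm]
    ring

/-- In the doubling identity the extreme terms `k = 0` and `k = n` contain the unknown moment
itself. Moving them to the left leaves the factor `2^n - 2`, nonzero for `n ≥ 2`; the other terms
are known by induction. -/
lemma IsStandardComplexGaussian.integral_monomial_self (hν : IsStandardComplexGaussian ν) (n : ℕ) :
    ∫ w, w ^ n * conj w ^ n ∂ν = 2 ^ n * n.factorial := by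
  induction n using Nat.strong_induction_on with
  | _ n ih =>
    rcases n with _ | _ | n
    · simp
    · simpa using hν.integral_normSq
    · have h := hν.two_pow_mul_integral_monomial (n + 2)
      rw [Finset.sum_range_succ, Finset.sum_range_succ'] at h
      have hs : ∀ k ∈ Finset.range (n + 1),
          ((n + 2).choose (k + 1) : ℂ) ^ 2 * (∫ w, w ^ (k + 1) * conj w ^ (k + 1) ∂ν) *
            ∫ w, w ^ (n + 2 - (k + 1)) * conj w ^ (n + 2 - (k + 1)) ∂ν =
          2 ^ (n + 2) * (n + 2).factorial * (n + 2).choose (k + 1) := fun k hk => by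
        have hk' := Finset.mem_range.1 hk
        rw [ih (k + 1) (by omega), ih (n + 2 - (k + 1)) (by omega)]
        have hc := Nat.choose_mul_factorial_mul_factorial (show k + 1 ≤ n + 2 by omega)
        have hc' : ((n + 2).choose (k + 1) : ℂ) * (k + 1).factorial *
          (n + 2 - (k + 1)).factorial = (n + 2).factorial := by exact_mod_cast hc
        have h2 : (2 : ℂ) ^ (n + 2) = 2 ^ (k + 1) * 2 ^ (n + 2 - (k + 1)) := by
          rw [← pow_add]; congr 1; omega
        rw [h2, ← hc']
        ring
      rw [Finset.sum_congr rfl hs, ← Finset.mul_sum] at h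
      have hsum : ∑ k ∈ Finset.range (n + 1), ((n + 2).choose (k + 1) : ℂ) = 2 ^ (n + 2) - 2 := by
        have := Nat.sum_range_choose (n + 2)
        rw [Finset.sum_range_succ, Finset.sum_range_succ'] at this
        have h' : ((∑ k ∈ Finset.range (n + 1), (n + 2).choose (k + 1) : ℕ) : ℂ) + 1 + 1 =
            2 ^ (n + 2) := by
          rw [Nat.choose_zero_right, Nat.choose_self] at this
          exact_mod_cast this
        push_cast at h'
        linear_combination h'
      rw [hsum] at h
      simp only [Nat.choose_zero_right, Nat.choose_self, pow_zero, mul_one, integral_const,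
        probReal_univ, one_smul, Nat.cast_one, one_pow, one_mul, Nat.sub_zero, Nat.sub_self] at h
      have hne : (2 : ℂ) ^ (n + 2) - 2 ≠ 0 := by
        rw [sub_ne_zero]
        intro hcon
        have : (2 : ℕ) ^ (n + 2) = 2 := by exact_mod_cast hcon
        have h4 : 2 ^ 2 ≤ 2 ^ (n + 2) := Nat.pow_le_pow_right (by norm_num) (by omega)
        omega
      apply mul_left_cancel₀ hne
      linear_combination h

/-- Wick's formula for the moments of a standard complex Gaussian. -/
lemma IsStandardComplexGaussian.integral_monomial_succ (hν : IsStandardComplexGaussian ν)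
    (m n : ℕ) : ∫ w, w ^ (m + 1) * conj w ^ n ∂ν =
      2 * (n * ∫ w, w ^ m * conj w ^ (n - 1) ∂ν) := by
  rcases n with _ | n
  · rw [hν.integral_monomial_of_ne (by omega)]
    simp
  · rw [Nat.add_sub_cancel]
    rcases eq_or_ne m n with rfl | h
    · rw [hν.integral_monomial_self, hν.integral_monomial_self, Nat.factorial_succ]
      push_cast
      ring
    · rw [hν.integral_monomial_of_ne h, hν.integral_monomial_of_ne (by omega)]
      simp

end Moments

/-! ### Mehler's formula for the Hermite-Laguerre-Itô polynomials -/

section MehlerFormula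

/-- `w^m w̄^n g(w)` and `w^m w̄^n g'(w)` are integrable and satisfy the Gaussian integration by parts
formula in which `g'` plays the role of `∂g/∂w̄`. -/
def SteinPair (ν : Measure ℂ) (g g' : ℂ → ℂ) : Prop :=
  ∀ m n : ℕ, Integrable (fun w => w ^ m * conj w ^ n * g w) ν ∧
    Integrable (fun w => w ^ m * conj w ^ n * g' w) ν ∧
    ∫ w, w ^ (m + 1) * conj w ^ n * g w ∂ν =
      2 * (n * (∫ w, w ^ m * conj w ^ (n - 1) * g w ∂ν) + ∫ w, w ^ m * conj w ^ n * g' w ∂ν)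

variable {ν : Measure ℂ} {g g' h h' : ℂ → ℂ}

lemma SteinPair.add (hg : SteinPair ν g g') (hh : SteinPair ν h h') :
    SteinPair ν (fun w => g w + h w) (fun w => g' w + h' w) := fun m n => by
  simp only [mul_add]
  refine ⟨(hg m n).1.add (hh m n).1, (hg m n).2.1.add (hh m n).2.1, ?_⟩
  rw [integral_add (hg _ _).1 (hh _ _).1, integral_add (hg _ _).1 (hh _ _).1,
    integral_add (hg _ _).2.1 (hh _ _).2.1, (hg m n).2.2, (hh m n).2.2]
  ring

lemma SteinPair.const_mul (c : ℂ) (hg : SteinPair ν g g') :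
    SteinPair ν (fun w => c * g w) (fun w => c * g' w) := fun m n => by
  simp only [mul_left_comm _ c]
  refine ⟨(hg m n).1.const_mul c, (hg m n).2.1.const_mul c, ?_⟩
  rw [integral_const_mul, integral_const_mul, integral_const_mul, (hg m n).2.2]
  ring

lemma SteinPair.id_mul (hg : SteinPair ν g g') :
    SteinPair ν (fun w => w * g w) (fun w => w * g' w) := fun m n => by
  have e : ∀ (k l : ℕ) (f : ℂ → ℂ), (fun w : ℂ => w ^ k * conj w ^ l * (w * f w)) =
      fun w => w ^ (k + 1) * conj w ^ l * f w := fun k l f => by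
    ext w
    ring
  simp only [e]
  exact ⟨(hg _ _).1, (hg _ _).2.1, (hg _ _).2.2⟩

lemma SteinPair.conj_mul (hg : SteinPair ν g g') :
    SteinPair ν (fun w => conj w * g w) (fun w => g w + conj w * g' w) := fun m n => by
  have e : ∀ (k l : ℕ) (f : ℂ → ℂ), (fun w : ℂ => w ^ k * conj w ^ l * (conj w * f w)) =
      fun w => w ^ k * conj w ^ (l + 1) * f w := fun k l f => by
    ext w
    ring
  simp only [mul_add (_ * _), e]
  refine ⟨(hg _ _).1, (hg _ _).1.add ?_, ?_⟩
  · rw [e]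
    exact (hg _ _).2.1
  · have e2 : ∀ w, w ^ m * conj w ^ n * (conj w * g' w) = w ^ m * conj w ^ (n + 1) * g' w :=
      fun w => congrFun (e m n g') w
    simp only [e2]
    rw [(hg _ _).2.2, integral_add (hg _ _).1 (hg _ _).2.1]
    rcases n with _ | n
    · simp
    · push_cast [Nat.add_sub_cancel]
      ring

lemma SteinPair.affine_mul (c b : ℂ) (hg : SteinPair ν g g') :
    SteinPair ν (fun w => (c + b * w) * g w) (fun w => (c + b * w) * g' w) := by
  have h := (hg.const_mul c).add (hg.id_mul.const_mul b)
  convert h using 2 <;> ring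

lemma SteinPair.conj_affine_mul (c : ℂ) (b : ℝ) (hg : SteinPair ν g g') :
    SteinPair ν (fun w => conj (c + b * w) * g w) (fun w => b * g w + conj (c + b * w) * g' w) := by
  have h := (hg.const_mul (conj c)).add (hg.conj_mul.const_mul (b : ℂ))
  convert h using 2 <;> simp only [map_add, map_mul, Complex.conj_ofReal] <;> ring

variable [IsProbabilityMeasure ν]

lemma IsStandardComplexGaussian.steinPair_one (hν : IsStandardComplexGaussian ν) :
    SteinPair ν (fun _ => 1) (fun _ => 0) := fun m n => by
  simp only [mul_one, mul_zero, integral_zero, add_zero]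
  exact ⟨hν.integrable_monomial m n, integrable_zero _ _ _, hν.integral_monomial_succ m n⟩

/-- Integration by parts is built up algebraically: Stein pairs contain `(1, 0)` and are stable
under linear combinations and under multiplication by affine functions of `w` and their conjugates,
which is all the recurrence uses. -/
lemma IsStandardComplexGaussian.steinPair_hermiteLaguerreIto (hν : IsStandardComplexGaussian ν)
    (c : ℂ) (b : ℝ) (m n : ℕ) :
    SteinPair ν (fun w => hermiteLaguerreIto m n (c + b * w))
      (fun w => b * n * hermiteLaguerreIto m (n - 1) (c + b * w)) := by
  induction m generalizing n with
  | zero =>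
    simp only [hermiteLaguerreIto_zero_left]
    induction n with
    | zero => simpa using hν.steinPair_one
    | succ n ih =>
      have h := ih.conj_affine_mul c b
      convert h using 2
      · rw [pow_succ']
      · rcases n with _ | n
        · simp
        · push_cast [Nat.add_sub_cancel]
          ring
  | succ m ih =>
    have h := ((ih n).affine_mul c b).add ((ih (n - 1)).const_mul (-(2 * n)))
    convert h using 2
    · rw [hermiteLaguerreIto_succ_left]
      ring
    · rw [hermiteLaguerreIto_succ_left]
      ring

/-- Antiholomorphic monomials of positive degree have mean zero, so only the constant term in `w`
survives. -/
lemma IsStandardComplexGaussian.integral_conj_affine_pow (hν : IsStandardComplexGaussian ν)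
    (c b : ℂ) (n : ℕ) : ∫ w, conj (c + b * w) ^ n ∂ν = conj c ^ n := by
  have h : ∀ w, conj (c + b * w) ^ n = ∑ k ∈ Finset.range (n + 1),
      (conj c ^ k * conj b ^ (n - k) * n.choose k) * (w ^ 0 * conj w ^ (n - k)) := fun w => by
    rw [map_add, map_mul, add_pow]
    refine Finset.sum_congr rfl fun k _ => ?_
    ring
  simp only [h]
  rw [integral_finsetSum _ fun k _ => (hν.integrable_monomial 0 (n - k)).const_mul _,
    Finset.sum_eq_single_of_mem n (Finset.self_mem_range_succ n)]
  · rw [integral_const_mul]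
    simp
  · intro k hk hkn
    have := Finset.mem_range.1 hk
    rw [integral_const_mul, hν.integral_monomial_of_ne (by omega), mul_zero]

/-- Mehler's formula in one complex variable. -/
lemma IsStandardComplexGaussian.integral_hermiteLaguerreIto (hν : IsStandardComplexGaussian ν)
    {a : ℂ} {b : ℝ} (hab : ‖a‖ ^ 2 + b ^ 2 = 1) (m n : ℕ) (z : ℂ) :
    ∫ w, hermiteLaguerreIto m n (a * z + b * w) ∂ν =
      a ^ m * conj a ^ n * hermiteLaguerreIto m n z := by
  induction m generalizing n with
  | zero =>
    simp only [hermiteLaguerreIto_zero_left]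
    rw [hν.integral_conj_affine_pow, map_mul, mul_pow]
    ring
  | succ m ih =>
    have hs := fun k => hν.steinPair_hermiteLaguerreIto (a * z) b m k
    have hi : ∀ k, Integrable (fun w => hermiteLaguerreIto m k (a * z + b * w)) ν := fun k => by
      simpa using (hs k 0 0).1
    have hi' : Integrable (fun w => w * hermiteLaguerreIto m n (a * z + b * w)) ν := by
      simpa using (hs n 1 0).1
    have hstein : ∫ w, w * hermiteLaguerreIto m n (a * z + b * w) ∂ν =
        2 * (b * n * ∫ w, hermiteLaguerreIto m (n - 1) (a * z + b * w) ∂ν) := by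
      have := (hs n 0 0).2.2
      rw [← integral_const_mul]
      simpa using this
    have hexp : ∀ w, hermiteLaguerreIto (m + 1) n (a * z + b * w) =
        (a * z * hermiteLaguerreIto m n (a * z + b * w) +
          b * (w * hermiteLaguerreIto m n (a * z + b * w))) -
          2 * n * hermiteLaguerreIto m (n - 1) (a * z + b * w) := fun w => by
      rw [hermiteLaguerreIto_succ_left]
      ring
    simp only [hexp]
    have hadd : Integrable (fun w => a * z * hermiteLaguerreIto m n (a * z + b * w) +
        b * (w * hermiteLaguerreIto m n (a * z + b * w))) ν :=
      ((hi n).const_mul _).add (hi'.const_mul _)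
    rw [integral_sub hadd ((hi (n - 1)).const_mul _),
      integral_add ((hi n).const_mul _) (hi'.const_mul _), integral_const_mul, integral_const_mul,
      integral_const_mul, hstein, ih, ih, hermiteLaguerreIto_succ_left]
    -- Integration by parts contributes `b²` and the recurrence `-1`, both times `2 n J_{m,n-1}`.
    -- Their sum `-|a|²` is exactly the factor needed to rebuild the recurrence at `z`.
    have hab' : conj a * a + (b : ℂ) ^ 2 = 1 := by
      rw [Complex.conj_mul']
      exact_mod_cast hab
    rcases n with _ | n
    · simp
      ring
    · rw [Nat.add_sub_cancel]
      linear_combination (2 * (n + 1 : ℕ) * a ^ m * conj a ^ n * hermiteLaguerreIto m n z) * hab'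

end MehlerFormula

/-! ### Fourier-Hermite-Itô polynomials of a family of functionals -/

section HermiteProd

variable {E κ : Type*} [NormedAddCommGroup E] [NormedSpace ℂ E]

/-- A product of Hermite-Laguerre-Itô polynomials in finitely many functionals. -/
def hermiteProd (φ : κ → StrongDual ℂ E) (s : Finset κ) (c : κ → ℂ) (A B : κ → ℕ) (x : E) : ℂ :=
  ∏ k ∈ s, c k * hermiteLaguerreIto (A k) (B k) (φ k x)

lemma continuous_hermiteProd (φ : κ → StrongDual ℂ E) (s : Finset κ) (c : κ → ℂ) (A B : κ → ℕ) :
    Continuous (hermiteProd φ s c A B) :=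
  continuous_finsetProd _ fun k _ => continuous_const.mul
    ((continuous_hermiteLaguerreIto _ _).comp (φ k).continuous)

lemma hasTrigDegree_hermiteProd (φ : κ → StrongDual ℂ E) (s : Finset κ) (c : κ → ℂ)
    (A B : κ → ℕ) : HasTrigDegree (∑ k ∈ s, (A k + B k)) (hermiteProd φ s c A B) :=
  HasTrigDegree.prod _ fun k _ => (hasTrigDegree_hermiteLaguerreIto (φ k) _ _).const_mul _

/-- The Fourier-Hermite-Itô polynomials of a family of functionals of a normed space. -/
def fourierHermite [DecidableEq κ] (φ : κ → StrongDual ℂ E) (A B : κ →₀ ℕ) : E → ℂ :=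
  hermiteProd φ (A.support ∪ B.support) (fun k =>
    ((1 / √(2 ^ (A k + B k) * (Nat.factorial (A k)) * (Nat.factorial (B k))) : ℝ) : ℂ)) A B

lemma sum_support_union_left [DecidableEq κ] (A B : κ →₀ ℕ) :
    ∑ k ∈ A.support ∪ B.support, A k = A.sum fun _ i => i :=
  (Finsupp.sum_of_support_subset A Finset.subset_union_left (fun _ i => i) fun _ _ => rfl).symm

lemma sum_support_union_right [DecidableEq κ] (A B : κ →₀ ℕ) :
    ∑ k ∈ A.support ∪ B.support, B k = B.sum fun _ i => i :=
  (Finsupp.sum_of_support_subset B Finset.subset_union_right (fun _ i => i) fun _ _ => rfl).symm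

lemma continuous_fourierHermite [DecidableEq κ] (φ : κ → StrongDual ℂ E) (A B : κ →₀ ℕ) :
    Continuous (fourierHermite φ A B) := continuous_hermiteProd ..

lemma hasTrigDegree_fourierHermite [DecidableEq κ] (φ : κ → StrongDual ℂ E) (A B : κ →₀ ℕ) :
    HasTrigDegree ((A.sum fun _ i => i) + B.sum fun _ i => i) (fourierHermite φ A B) := by
  rw [← sum_support_union_left A B, ← sum_support_union_right A B, ← Finset.sum_add_distrib]
  exact hasTrigDegree_hermiteProd φ _ _ A B

end HermiteProd

/-! ### Coordinates given by an orthonormal family of functionals -/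

section Coordinates

variable {E H κ : Type*} [NormedAddCommGroup E] [NormedSpace ℝ E] [NormedSpace ℂ E]
  [IsScalarTower ℝ ℂ E] [MeasurableSpace E] [BorelSpace E]
  [NormedAddCommGroup H] [InnerProductSpace ℂ H] [NormedSpace ℝ H] [IsScalarTower ℝ ℂ H]
  [CompleteSpace H] {ι : H →L[ℂ] E} {μ : Measure E}

lemma HasGaussianCharFun.charFunDual_map_dual (hμ : HasGaussianCharFun ι μ)
    {φ : StrongDual ℂ E} {e : H} (he : ∀ h, φ (ι h) = ⟪e, h⟫_ℂ) {L : StrongDual ℝ ℂ} {c : ℂ}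
    (hc : ∀ w, L w = (conj c * w).re) :
    charFunDual (μ.map φ) L = Complex.exp (-(‖c • e‖ : ℂ) ^ 2 / 2) := by
  have hmap : charFunDual (μ.map φ) L = charFunDual μ (L.comp (φ.restrictScalars ℝ)) :=
    charFunDual_map (μ := μ) (φ.restrictScalars ℝ) L
  rw [hmap]
  refine hμ.eq_of_riesz fun h => ?_
  rw [inner_smul_left, ← he]
  exact hc _

lemma exists_eq_re_conj_mul (L : StrongDual ℝ ℂ) : ∃ c : ℂ, ∀ w, L w = (conj c * w).re := by
  obtain ⟨c, hc⟩ := exists_riesz_re (ContinuousLinearMap.id ℂ ℂ) L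
  refine ⟨c, fun w => (hc w).trans ?_⟩
  rw [RCLike.inner_apply']

lemma HasGaussianCharFun.isStandardComplexGaussian_map (hμ : HasGaussianCharFun ι μ)
    {φ : StrongDual ℂ E} {e : H} (he : ∀ h, φ (ι h) = ⟪e, h⟫_ℂ) (hn : ‖e‖ = 1) :
    IsStandardComplexGaussian (μ.map φ) := by
  intro L
  obtain ⟨c, hc⟩ := exists_eq_re_conj_mul L
  rw [hμ.charFunDual_map_dual he hc, norm_smul, hn, mul_one,
    norm_comp_restrictScalars_eq (ι := ContinuousLinearMap.id ℂ ℂ) (v := c) fun h => ?_]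
  rw [RCLike.inner_apply']
  exact hc h

/-- The joint characteristic functional factorises because `‖∑ c_k e_k‖² = ∑ ‖c_k e_k‖²` by
orthonormality. -/
lemma HasGaussianCharFun.iIndepFun_dual [IsProbabilityMeasure μ] [Fintype κ]
    (hμ : HasGaussianCharFun ι μ)
    {φ : κ → StrongDual ℂ E} {e : κ → H} (he : ∀ k h, φ k (ι h) = ⟪e k, h⟫_ℂ)
    (hon : Orthonormal ℂ e) : iIndepFun (fun k => (φ k : E → ℂ)) μ := by
  classical
  rw [iIndepFun_iff_charFunDual_pi fun k => (φ k).continuous.measurable.aemeasurable]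
  intro L
  choose c hc using fun k => exists_eq_re_conj_mul (L.comp (.single ℝ (fun _ : κ => ℂ) k))
  have hL : ∀ z : κ → ℂ, L z = ∑ k, (conj (c k) * z k).re := fun z => by
    conv_lhs => rw [← Finset.univ_sum_single z]
    rw [map_sum]
    exact Finset.sum_congr rfl fun k _ => hc k (z k)
  let Φ : E →L[ℝ] κ → ℂ := ContinuousLinearMap.pi fun k => (φ k).restrictScalars ℝ
  have hmap : charFunDual (μ.map fun x k => φ k x) L = charFunDual μ (L.comp Φ) :=
    charFunDual_map (μ := μ) Φ L
  have hnorm : ‖∑ k, c k • e k‖ ^ 2 = ∑ k, ‖c k • e k‖ ^ 2 := by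
    have h := hon.inner_sum c c Finset.univ
    rw [inner_self_eq_norm_sq_to_K] at h
    have h2 : ((‖∑ k, c k • e k‖ ^ 2 : ℝ) : ℂ) = ((∑ k, ‖c k • e k‖ ^ 2 : ℝ) : ℂ) := by
      push_cast
      refine h.trans (Finset.sum_congr rfl fun k _ => ?_)
      rw [Complex.conj_mul', norm_smul, hon.1, mul_one]
    exact_mod_cast h2
  rw [hmap, hμ.eq_of_riesz (v := ∑ k, c k • e k) fun h => ?_]
  · rw [Finset.prod_congr rfl fun k _ => hμ.charFunDual_map_dual (he k) (hc k),
      ← Complex.exp_sum]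
    congr 1
    rw [← Finset.sum_div, Finset.sum_neg_distrib]
    congr 2
    exact_mod_cast hnorm
  · rw [sum_inner, Complex.re_sum]
    refine (hL _).trans (Finset.sum_congr rfl fun k _ => ?_)
    rw [inner_smul_left, ← he]
    rfl


/-- For fixed `x` the integrand is a product of functions of the independent variables `φ_k(y)`, so
the integral splits into one-variable Mehler formulas. -/
lemma HasGaussianCharFun.mehler_hermiteProd [IsProbabilityMeasure μ]
    (hμ : HasGaussianCharFun ι μ)
    {φ : κ → StrongDual ℂ E} {e : κ → H} (he : ∀ k h, φ k (ι h) = ⟪e k, h⟫_ℂ)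
    (hon : Orthonormal ℂ e) {a : ℂ} {b : ℝ} (hab : ‖a‖ ^ 2 + b ^ 2 = 1)
    (s : Finset κ) (c : κ → ℂ) (A B : κ → ℕ) (x : E) :
    mehler μ a b (hermiteProd φ s c A B) x =
      a ^ (∑ k ∈ s, A k) * conj a ^ (∑ k ∈ s, B k) * hermiteProd φ s c A B x := by
  have hind : iIndepFun (fun k : s => (φ k : E → ℂ)) μ :=
    hμ.iIndepFun_dual (fun k h => he k h) (hon.comp _ Subtype.val_injective)
  let f : s → ℂ → ℂ := fun k w => c k * hermiteLaguerreIto (A k) (B k) (a * φ k x + b * w)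
  have hf : ∀ k, Continuous (f k) := fun k => continuous_const.mul
    ((continuous_hermiteLaguerreIto _ _).comp (by fun_prop))
  have h1 : mehler μ a b (hermiteProd φ s c A B) x = ∫ y, ∏ k : s, f k (φ k y) ∂μ := by
    refine integral_congr_ae (Filter.Eventually.of_forall fun y => ?_)
    change ∏ k ∈ s, c k * hermiteLaguerreIto (A k) (B k) (φ k (a • x + (b : ℂ) • y)) = _
    rw [← Finset.prod_coe_sort]
    refine Finset.prod_congr rfl fun k _ => ?_
    rw [map_add, map_smul, map_smul, smul_eq_mul, smul_eq_mul]
  have h2 : ∀ k : s, ∫ y, f k (φ k y) ∂μ =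
      a ^ A k * conj a ^ B k * (c k * hermiteLaguerreIto (A k) (B k) (φ k x)) := fun k => by
    have hm := (φ k).continuous.measurable
    have := Measure.isProbabilityMeasure_map (μ := μ) hm.aemeasurable
    rw [← integral_map (φ := φ k) hm.aemeasurable (hf k).aestronglyMeasurable,
      integral_const_mul, (hμ.isStandardComplexGaussian_map
        (he k) (hon.1 k)).integral_hermiteLaguerreIto hab]
    ring
  rw [h1, hind.integral_fun_prod_comp (fun k => (φ k).continuous.measurable.aemeasurable)
    (fun k => (hf k).aestronglyMeasurable), Finset.prod_congr rfl fun k _ => h2 k,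
    Finset.prod_coe_sort s fun k =>
      a ^ A k * conj a ^ B k * (c k * hermiteLaguerreIto (A k) (B k) (φ k x)),
    Finset.prod_mul_distrib, Finset.prod_mul_distrib, Finset.prod_pow_eq_pow_sum,
    Finset.prod_pow_eq_pow_sum]
  rfl

lemma HasGaussianCharFun.mehler_fourierHermite [DecidableEq κ] [IsProbabilityMeasure μ]
    (hμ : HasGaussianCharFun ι μ)
    {φ : κ → StrongDual ℂ E} {e : κ → H} (he : ∀ k h, φ k (ι h) = ⟪e k, h⟫_ℂ)
    (hon : Orthonormal ℂ e) {a : ℂ} {b : ℝ} (hab : ‖a‖ ^ 2 + b ^ 2 = 1)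
    (A B : κ →₀ ℕ) (x : E) :
    mehler μ a b (fourierHermite φ A B) x =
      a ^ (A.sum fun _ i => i) * conj a ^ (B.sum fun _ i => i) * fourierHermite φ A B x := by
  rw [← sum_support_union_left A B, ← sum_support_union_right A B]
  exact hμ.mehler_hermiteProd he hon hab _ _ A B x

end Coordinates

lemma rieszRep_inner {T : ℝ} (ψ : StrongDual ℂ (WienerSpace T)) (h : CameronMartin T) :
    ψ (cameronMartinEmbedding T h) = ⟪rieszRep ψ, h⟫_ℂ := by
  rw [rieszRep, InnerProductSpace.toDual_symm_apply]
  rfl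

/-! ### Operators on `L^p` extending operators on `L²` -/

section ExtendsL2

variable {α : Type*} [MeasurableSpace α] {μ : Measure α} {p : ℝ≥0∞} [Fact (1 ≤ p)]

/-- The operator `A` on `L^p` agrees with the operator `A₂` on `L²` on `L² ∩ L^p`. -/
def ExtendsL2 (A : Lp ℂ p μ →L[ℂ] Lp ℂ p μ) (A₂ : Lp ℂ 2 μ →L[ℂ] Lp ℂ 2 μ) : Prop :=
  ∀ (F : Lp ℂ 2 μ) (hF : MemLp F p μ), A (hF.toLp F) =ᵐ[μ] A₂ F

variable {A B : Lp ℂ p μ →L[ℂ] Lp ℂ p μ} {A₂ B₂ : Lp ℂ 2 μ →L[ℂ] Lp ℂ 2 μ}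

lemma ExtendsL2.unique [IsFiniteMeasure μ] (hp : p ≠ ∞) (hA : ExtendsL2 A A₂)
    (hB : ExtendsL2 B A₂) : A = B :=
  clm_ext_of_memL2 hp fun F hF => Lp.ext ((hA F hF).trans (hB F hF).symm)

/-- Composition makes sense on `L² ∩ L^p` because `B₂ F` agrees with an element of `L^p`, namely the
value of `B`. -/
lemma ExtendsL2.comp (hA : ExtendsL2 A A₂) (hB : ExtendsL2 B B₂) :
    ExtendsL2 (A.comp B) (A₂.comp B₂) := fun F hF => by
  have hm : MemLp (B₂ F) p μ := (Lp.memLp (B (hF.toLp F))).ae_eq (hB F hF)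
  have h : B (hF.toLp F) = hm.toLp (B₂ F) := Lp.ext ((hB F hF).trans hm.coeFn_toLp.symm)
  rw [ContinuousLinearMap.comp_apply, h]
  exact hA _ hm

lemma ExtendsL2.const_smul (c : ℂ) (hA : ExtendsL2 A A₂) : ExtendsL2 (c • A) (c • A₂) :=
  fun F hF => by
    filter_upwards [hA F hF, Lp.coeFn_smul c (A (hF.toLp F)), Lp.coeFn_smul c (A₂ F)]
      with x h1 h2 h3
    rw [smul_apply, smul_apply, h2, h3, Pi.smul_apply,
      Pi.smul_apply, h1]

lemma ExtendsL2.zero : ExtendsL2 (0 : Lp ℂ p μ →L[ℂ] Lp ℂ p μ) 0 := fun F hF => by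
  filter_upwards [Lp.coeFn_zero ℂ p μ, Lp.coeFn_zero ℂ 2 μ] with x h1 h2
  rw [zero_apply, zero_apply, h1, h2]

end ExtendsL2

/-! ### The Ornstein-Uhlenbeck operators on `L²` -/

section MehlerL2

variable {E : Type*} [NormedAddCommGroup E] [NormedSpace ℂ E] [MeasurableSpace E]
  {μ : Measure E} [IsProbabilityMeasure μ] {a : ℂ} {b : ℝ}

/-- The Ornstein-Uhlenbeck operator `mehler μ a b` as a bounded operator on `L^p`. -/
def mehlerCLM (hμ : RotationInvariant μ) (hab : ‖a‖ ^ 2 + b ^ 2 = 1) (p : ℝ≥0∞)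
    [Fact (1 ≤ p)] (hp : p ≠ ∞) : Lp ℂ p μ →L[ℂ] Lp ℂ p μ :=
  (exists_mehler_clm hμ hab p hp).choose

lemma mehlerCLM_toLp (hμ : RotationInvariant μ) (hab : ‖a‖ ^ 2 + b ^ 2 = 1) {p : ℝ≥0∞}
    [Fact (1 ≤ p)] (hp : p ≠ ∞) {F : E → ℂ} (hF : MemLp F p μ) :
    mehlerCLM hμ hab p hp (hF.toLp F) =ᵐ[μ] mehler μ a b F :=
  (exists_mehler_clm hμ hab p hp).choose_spec F hF

lemma mehlerCLM_coeFn (hμ : RotationInvariant μ) (hab : ‖a‖ ^ 2 + b ^ 2 = 1) {p : ℝ≥0∞}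
    [Fact (1 ≤ p)] (hp : p ≠ ∞) (F : Lp ℂ p μ) :
    mehlerCLM hμ hab p hp F =ᵐ[μ] mehler μ a b F := by
  conv_lhs => rw [← Lp.toLp_coeFn F (Lp.memLp F)]
  exact mehlerCLM_toLp hμ hab hp _

lemma extendsL2_mehlerCLM (hμ : RotationInvariant μ) (hab : ‖a‖ ^ 2 + b ^ 2 = 1) {p : ℝ≥0∞}
    [Fact (1 ≤ p)] (hp : p ≠ ∞) :
    ExtendsL2 (mehlerCLM hμ hab p hp) (mehlerCLM hμ hab 2 ENNReal.ofNat_ne_top) := fun F hF =>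
  (mehlerCLM_toLp hμ hab hp hF).trans (mehlerCLM_coeFn hμ hab _ F).symm

lemma norm_conj_sq_add (hab : ‖a‖ ^ 2 + b ^ 2 = 1) : ‖conj a‖ ^ 2 + b ^ 2 = 1 := by
  rwa [RCLike.norm_conj]

/-- The bilinear adjoint identity applied to `F` and the conjugate of `G`; a Mehler integral
commutes with conjugation of the function. -/
lemma inner_mehlerCLM (hμ : RotationInvariant μ) (hab : ‖a‖ ^ 2 + b ^ 2 = 1) (F G : Lp ℂ 2 μ) :
    ⟪G, mehlerCLM hμ hab 2 ENNReal.ofNat_ne_top F⟫_ℂ =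
      ⟪mehlerCLM hμ (norm_conj_sq_add hab) 2 ENNReal.ofNat_ne_top G, F⟫_ℂ := by
  rw [L2.inner_def, L2.inner_def]
  have h := integral_mehler_mul hμ hab (Lp.memLp F) (Lp.memLp G).star
  refine Eq.trans (integral_congr_ae ?_) (h.trans (integral_congr_ae ?_))
  · filter_upwards [mehlerCLM_coeFn hμ hab ENNReal.ofNat_ne_top F] with x hx
    rw [hx, RCLike.inner_apply']
    exact mul_comm _ _
  · filter_upwards [mehlerCLM_coeFn hμ (norm_conj_sq_add hab) ENNReal.ofNat_ne_top G] with x hx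
    rw [hx, RCLike.inner_apply', mul_comm]
    congr 1
    exact integral_conj

end MehlerL2

/-! ### The Itô-Wiener chaoses -/

section Chaos

variable {E κ : Type*} [NormedAddCommGroup E] [NormedSpace ℂ E] [MeasurableSpace E]
  [DecidableEq κ]

/-- The algebraic linear span of the Fourier-Hermite-Itô polynomials of bidegree `(m, n)`. -/
def hermiteSpan (μ : Measure E) (φ : κ → StrongDual ℂ E) (m n : ℕ) : Submodule ℂ (Lp ℂ 2 μ) :=
  Submodule.span ℂ {F : Lp ℂ 2 μ | ∃ A B : κ →₀ ℕ, (A.sum fun _ i => i) = m ∧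
    (B.sum fun _ i => i) = n ∧ F =ᵐ[μ] fourierHermite φ A B}

/-- The Itô-Wiener chaos of bidegree `(m, n)`. -/
def hermiteChaos (μ : Measure E) (φ : κ → StrongDual ℂ E) (m n : ℕ) : Submodule ℂ (Lp ℂ 2 μ) :=
  (hermiteSpan μ φ m n).topologicalClosure

variable {μ : Measure E} {φ : κ → StrongDual ℂ E} {m n : ℕ}

instance instCompleteSpaceHermiteChaos : CompleteSpace (hermiteChaos μ φ m n) :=
  Submodule.topologicalClosure.completeSpace _

/-- Trigonometric degree is a pointwise property, so it is recorded for continuous representatives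
on the algebraic span, before closing up in `L²`. -/
lemma exists_continuous_of_mem_hermiteSpan {F : Lp ℂ 2 μ} (hF : F ∈ hermiteSpan μ φ m n) :
    ∃ f : E → ℂ, Continuous f ∧ HasTrigDegree (m + n) f ∧ F =ᵐ[μ] f := by
  induction hF using Submodule.span_induction with
  | mem F hF =>
    obtain ⟨A, B, rfl, rfl, h⟩ := hF
    exact ⟨_, continuous_fourierHermite φ A B, hasTrigDegree_fourierHermite φ A B, h⟩
  | zero => exact ⟨fun _ => 0, continuous_const, hasTrigDegree_const _ 0, Lp.coeFn_zero ℂ 2 μ⟩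
  | add F G _ _ hF hG =>
    obtain ⟨f, hf, hfd, hfF⟩ := hF
    obtain ⟨g, hg, hgd, hgG⟩ := hG
    exact ⟨f + g, hf.add hg, hfd.add hgd, (Lp.coeFn_add F G).trans (hfF.add hgG)⟩
  | smul c F _ hF =>
    obtain ⟨f, hf, hfd, hfF⟩ := hF
    exact ⟨fun x => c * f x, continuous_const.mul hf, hfd.const_mul c,
      (Lp.coeFn_smul c F).trans (hfF.const_smul c)⟩

variable [IsProbabilityMeasure μ]

lemma lpNormsEquivalent_hermiteChaos [BorelSpace E] [SecondCountableTopology E]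
    (hμ : RotationInvariant μ) :
    LpNormsEquivalent (hermiteChaos μ φ m n) := by
  refine LpNormsEquivalent.topologicalClosure fun p q hp1 hp hq1 hq => ?_
  obtain ⟨K, hK⟩ := hμ.exists_eLpNorm_le (m + n) (one_pos.trans_le hp1).ne' hp
    (one_pos.trans_le hq1).ne' hq
  refine ⟨K, fun F hF => ?_⟩
  obtain ⟨f, hf, hfd, hfF⟩ := exists_continuous_of_mem_hermiteSpan hF
  rw [eLpNorm_congr_ae hfF, eLpNorm_congr_ae hfF]
  exact hK f hf hfd

/-- The Fourier-Hermite-Itô polynomials are eigenfunctions of all Ornstein-Uhlenbeck operators. -/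
def MehlerEigen (μ : Measure E) (φ : κ → StrongDual ℂ E) : Prop :=
  ∀ (a : ℂ) (b : ℝ), ‖a‖ ^ 2 + b ^ 2 = 1 → ∀ (A B : κ →₀ ℕ) (x : E),
    mehler μ a b (fourierHermite φ A B) x =
      a ^ (A.sum fun _ i => i) * conj a ^ (B.sum fun _ i => i) * fourierHermite φ A B x

variable {a : ℂ} {b : ℝ}

lemma MehlerEigen.mehlerCLM_apply (hφ : MehlerEigen μ φ) (hμ : RotationInvariant μ)
    (hab : ‖a‖ ^ 2 + b ^ 2 = 1) {F : Lp ℂ 2 μ} (hF : F ∈ hermiteChaos μ φ m n) :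
    mehlerCLM hμ hab 2 ENNReal.ofNat_ne_top F = (a ^ m * conj a ^ n) • F := by
  set S := mehlerCLM hμ hab 2 ENNReal.ofNat_ne_top
  let V : Submodule ℂ (Lp ℂ 2 μ) := LinearMap.eqLocus (S : Lp ℂ 2 μ →ₗ[ℂ] Lp ℂ 2 μ)
    ((a ^ m * conj a ^ n) • LinearMap.id)
  have hVc : IsClosed (V : Set (Lp ℂ 2 μ)) :=
    isClosed_eq S.continuous (continuous_const_smul (a ^ m * conj a ^ n))
  refine Submodule.topologicalClosure_minimal (t := V) _ (Submodule.span_le.2 ?_) hVc hF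
  rintro G ⟨A, B, rfl, rfl, hG⟩
  refine Lp.ext ?_
  filter_upwards [mehlerCLM_coeFn hμ hab ENNReal.ofNat_ne_top G, mehler_congr_ae hμ hab hG, hG,
    Lp.coeFn_smul (a ^ (A.sum fun _ i => i) * conj a ^ (B.sum fun _ i => i)) G] with x h1 h2 h3 h4
  refine (h1.trans h2).trans (Eq.trans ?_ h4.symm)
  rw [hφ a b hab, Pi.smul_apply, h3, smul_eq_mul]

/-- Moving the operator across the inner product forces `a^m ā^n = a^i ā^j` for every admissible
`a`. A real `a` in `(0, 1)` detects the total degree and a unimodular `a` detects the difference `m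
- n`. -/
lemma MehlerEigen.eq_of_inner_ne_zero (hφ : MehlerEigen μ φ) (hμ : RotationInvariant μ)
    {i j : ℕ} {F G : Lp ℂ 2 μ} (hF : F ∈ hermiteChaos μ φ m n) (hG : G ∈ hermiteChaos μ φ i j)
    (h0 : ⟪G, F⟫_ℂ ≠ 0) : m = i ∧ n = j := by
  have key : ∀ (a : ℂ) (b : ℝ), ‖a‖ ^ 2 + b ^ 2 = 1 →
      a ^ m * conj a ^ n = a ^ i * conj a ^ j := fun a b hab => by
    have h := inner_mehlerCLM hμ hab F G
    rw [hφ.mehlerCLM_apply hμ _ hF, hφ.mehlerCLM_apply hμ _ hG, inner_smul_right,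
      inner_smul_left] at h
    simpa [h0, mul_comm] using h
  have h1 : m + n = i + j := by
    have h := key (1 / 2 : ℝ) (√(3 / 4)) (by
      rw [Complex.norm_real, Real.norm_eq_abs, sq_abs, Real.sq_sqrt (by norm_num)]
      norm_num)
    rw [Complex.conj_ofReal, ← pow_add, ← pow_add] at h
    have h' : (1 / 2 : ℝ) ^ (m + n) = (1 / 2 : ℝ) ^ (i + j) := by exact_mod_cast h
    exact pow_right_injective₀ (by norm_num) (by norm_num) h'
  have h2 : m + j = i + n := by
    -- A primitive root of unity of order larger than both exponents separates them.
    set N := m + j + (i + n) + 1 with hN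
    have hζ := Complex.isPrimitiveRoot_exp N (by omega)
    set ζ := Complex.exp (2 * Real.pi * Complex.I / N)
    have hn : ‖ζ‖ = 1 := hζ.norm'_eq_one (by omega)
    have hc : ζ * conj ζ = 1 := by rw [Complex.mul_conj']; simp [hn]
    refine hζ.pow_inj (by omega) (by omega) ?_
    have h := key ζ 0 (by simp [hn])
    calc ζ ^ (m + j) = ζ ^ m * ζ ^ j * (ζ * conj ζ) ^ n := by rw [hc, one_pow, mul_one, pow_add]
      _ = (ζ ^ m * conj ζ ^ n) * (ζ ^ j * ζ ^ n) := by rw [mul_pow]; ring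
      _ = ζ ^ i * ζ ^ n * (ζ * conj ζ) ^ j := by rw [h, mul_pow]; ring
      _ = ζ ^ (i + n) := by rw [hc, one_pow, mul_one, pow_add]
  omega

lemma MehlerEigen.starProjection_comp (hφ : MehlerEigen μ φ) (hμ : RotationInvariant μ)
    (m n i j : ℕ) :
    (hermiteChaos μ φ m n).starProjection.comp (hermiteChaos μ φ i j).starProjection =
      if m = i ∧ n = j then (hermiteChaos μ φ m n).starProjection else 0 := by
  split_ifs with h
  · obtain ⟨rfl, rfl⟩ := h
    exact Submodule.isIdempotentElem_starProjection _
  · refine Submodule.IsOrtho.starProjection_comp_starProjection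
      (Submodule.isOrtho_iff_inner_eq.2 fun F hF G hG => ?_)
    by_contra h0
    exact h ((hφ.eq_of_inner_ne_zero hμ hG hF h0).imp Eq.symm Eq.symm)

lemma MehlerEigen.mehlerCLM_comp_starProjection (hφ : MehlerEigen μ φ) (hμ : RotationInvariant μ)
    (hab : ‖a‖ ^ 2 + b ^ 2 = 1) (m n : ℕ) :
    (mehlerCLM hμ hab 2 ENNReal.ofNat_ne_top).comp (hermiteChaos μ φ m n).starProjection =
      (a ^ m * conj a ^ n) • (hermiteChaos μ φ m n).starProjection := by
  ext1 F
  exact hφ.mehlerCLM_apply hμ hab (Submodule.starProjection_apply_mem _ F)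

/-- Tested against `G`, both factors move to the other side, where the adjoint operator acts on the
projection of `G` by the conjugate eigenvalue. -/
lemma MehlerEigen.starProjection_comp_mehlerCLM (hφ : MehlerEigen μ φ) (hμ : RotationInvariant μ)
    (hab : ‖a‖ ^ 2 + b ^ 2 = 1) (m n : ℕ) :
    (hermiteChaos μ φ m n).starProjection.comp (mehlerCLM hμ hab 2 ENNReal.ofNat_ne_top) =
      (a ^ m * conj a ^ n) • (hermiteChaos μ φ m n).starProjection := by
  ext1 F
  refine ext_inner_left ℂ fun G => ?_
  rw [ContinuousLinearMap.comp_apply, ← Submodule.inner_starProjection_left_eq_right,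
    inner_mehlerCLM, hφ.mehlerCLM_apply hμ _ (Submodule.starProjection_apply_mem _ G),
    smul_apply, inner_smul_left, inner_smul_right,
    Submodule.inner_starProjection_left_eq_right]
  simp

end Chaos

/-! ### Chaos projections and Ornstein-Uhlenbeck operators on `L^p` -/

section GaussianChaos

variable {E κ : Type*} [NormedAddCommGroup E] [NormedSpace ℂ E] [MeasurableSpace E] [BorelSpace E]
  [SecondCountableTopology E] [DecidableEq κ] {μ : Measure E} [IsProbabilityMeasure μ]
  {φ : κ → StrongDual ℂ E}

/-- The projections onto the chaoses and the Ornstein-Uhlenbeck operators on `L^p`. -/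
lemma MehlerEigen.exists_projections (hφ : MehlerEigen μ φ) (hμ : RotationInvariant μ) (p : ℝ≥0∞)
    [Fact (1 ≤ p)] (hp1 : 1 < p) (hp : p ≠ ∞) :
    ∃ J : ℕ → ℕ → (Lp ℂ p μ →L[ℂ] Lp ℂ p μ),
      (∀ m n, ExtendsL2 (J m n) (hermiteChaos μ φ m n).starProjection) ∧
      (∀ m n i j, (J m n).comp (J i j) = (if m = i ∧ n = j then J m n else 0) ∧
        (J i j).comp (J m n) = (if m = i ∧ n = j then J m n else 0)) ∧
      ∀ (a : ℂ) (b : ℝ), ‖a‖ ^ 2 + b ^ 2 = 1 →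
        ∃ S : Lp ℂ p μ →L[ℂ] Lp ℂ p μ,
          (∀ (F : E → ℂ) (hF : MemLp F p μ), S (hF.toLp F) =ᵐ[μ] mehler μ a b F) ∧
          ∀ m n : ℕ, S.comp (J m n) = (a ^ m * conj a ^ n) • J m n ∧
            (J m n).comp S = (a ^ m * conj a ^ n) • J m n := by
  choose J hJ using fun m n =>
    (lpNormsEquivalent_hermiteChaos (φ := φ) (m := m) (n := n) hμ).exists_starProjection_extension
      hp1 hp
  have hJ : ∀ m n, ExtendsL2 (J m n) (hermiteChaos μ φ m n).starProjection := hJ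
  have hcomp : ∀ m n i j, (J m n).comp (J i j) = (if m = i ∧ n = j then J m n else 0) :=
    fun m n i j => by
      have h := (hJ m n).comp (hJ i j)
      rw [hφ.starProjection_comp hμ] at h
      split_ifs at h ⊢ with hmn
      · exact h.unique hp (hJ m n)
      · exact h.unique hp .zero
  refine ⟨J, hJ, fun m n i j => ⟨hcomp m n i j, ?_⟩, fun a b hab =>
    ⟨mehlerCLM hμ hab p hp, fun F hF => mehlerCLM_toLp hμ hab hp hF, fun m n => ⟨?_, ?_⟩⟩⟩
  · rw [hcomp i j m n]
    split_ifs with h1 h2 h2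
    · rw [h1.1, h1.2]
    · exact absurd ⟨h1.1.symm, h1.2.symm⟩ h2
    · exact absurd ⟨h2.1.symm, h2.2.symm⟩ h1
    · rfl
  · have h := (extendsL2_mehlerCLM hμ hab hp).comp (hJ m n)
    rw [hφ.mehlerCLM_comp_starProjection] at h
    exact h.unique hp ((hJ m n).const_smul _)
  · have h := (hJ m n).comp (extendsL2_mehlerCLM hμ hab hp)
    rw [hφ.starProjection_comp_mehlerCLM] at h
    exact h.unique hp ((hJ m n).const_smul _)

end GaussianChaos

lemma norm_exp_sq_add (θ t : ℝ) (hθ : θ ∈ Set.Ioo (-(Real.pi / 2)) (Real.pi / 2)) (ht : 0 ≤ t) :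
    ‖Complex.exp (-(Real.cos θ + Complex.I * Real.sin θ) * t)‖ ^ 2 +
      √(1 - Real.exp (-2 * t * Real.cos θ)) ^ 2 = 1 := by
  have hc : 0 < Real.cos θ := Real.cos_pos_of_mem_Ioo hθ
  have h1 : Real.exp (-2 * t * Real.cos θ) ≤ 1 := by
    rw [Real.exp_le_one_iff]
    nlinarith
  rw [Real.sq_sqrt (by linarith), Complex.norm_exp, ← Real.exp_nat_mul]
  have h2 : (-((Real.cos θ : ℂ) + Complex.I * Real.sin θ) * t).re = -Real.cos θ * t := by
    simp [-Complex.ofReal_cos, -Complex.ofReal_sin]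
  rw [h2, show ((2 : ℕ) : ℝ) * (-Real.cos θ * t) = -2 * t * Real.cos θ by push_cast; ring]
  ring

/-- Matches the abstract eigenvalue `a^m ā^n` with the exponential form for the semigroup parameter
`a`. -/
lemma exp_pow_mul_conj_exp_pow (θ t : ℝ) (m n : ℕ) :
    Complex.exp (-(Real.cos θ + Complex.I * Real.sin θ) * t) ^ m *
      conj (Complex.exp (-(Real.cos θ + Complex.I * Real.sin θ) * t)) ^ n =
    Complex.exp (-((m : ℂ) + n) * t * Real.cos θ -
      Complex.I * ((m : ℂ) - n) * t * Real.sin θ) := by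
  rw [← Complex.exp_conj, ← Complex.exp_nat_mul, ← Complex.exp_nat_mul, ← Complex.exp_add]
  congr 1
  simp only [map_mul, map_neg, map_add, Complex.conj_ofReal, Complex.conj_I]
  ring

/-- A sequence of functionals, with the topology of the space coming syntactically from its norm. -/
def toNormedDual (E : Type*) [NormedAddCommGroup E] [NormedSpace ℂ E] (φ : ℕ → StrongDual ℂ E) :
    ℕ → StrongDual ℂ E := φ

lemma IsComplexWienerMeasure.mehlerEigen {T : ℝ} {μ : Measure (WienerSpace T)}
    (hμ : IsComplexWienerMeasure μ) {φ : ℕ → StrongDual ℂ (WienerSpace T)}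
    (hφ : Orthonormal ℂ fun k => rieszRep (φ k)) : MehlerEigen μ (toNormedDual (WienerSpace T) φ) := by
  have := hμ.isProbabilityMeasure
  have hμ' : HasGaussianCharFun (cameronMartinEmbedding T) μ := fun L => hμ.charFunDual_eq L
  intro a b hab A B x
  exact hμ'.mehler_fourierHermite (fun k h => rieszRep_inner (φ k) h) hφ hab A B x

/-- Transfers the results for a general normed space to the concrete chaoses, the two constructions
being definitionally the same. -/
lemma chaos_eq_hermiteChaos {T : ℝ} (μ : Measure (WienerSpace T))
    (φ : ℕ → StrongDual ℂ (WienerSpace T)) (m n : ℕ) :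
    chaos μ φ m n = hermiteChaos μ (toNormedDual (WienerSpace T) φ) m n := rfl

lemma IsComplexWienerMeasure.lpNormsEquivalent_chaos {T : ℝ} {μ : Measure (WienerSpace T)}
    (hμ : IsComplexWienerMeasure μ) (φ : ℕ → StrongDual ℂ (WienerSpace T)) (m n : ℕ) :
    LpNormsEquivalent (chaos μ φ m n) := by
  have := hμ.isProbabilityMeasure
  rw [chaos_eq_hermiteChaos]
  exact lpNormsEquivalent_hermiteChaos hμ.rotationInvariant

end ComplexWiener

end

open ComplexWiener in
theorem mainTheorem4 (T : ℝ) (hT : 0 < T) (μ : Measure (WienerSpace T))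
    (hμ : IsComplexWienerMeasure μ) (φ : ℕ → StrongDual ℂ (WienerSpace T))
    (hφ : IsCompleteOrthonormalSystem φ) :
    -- each chaos is a closed subspace of every `L^p`, and its `L^p` norms are equivalent
    (∀ m n : ℕ,
      (∀ (p : ℝ≥0∞) [Fact (1 ≤ p)], 1 < p → p ≠ ∞ →
        (∀ F ∈ chaos μ φ m n, MemLp F p μ) ∧
        IsClosed (chaosLp μ φ p m n : Set (Lp ℂ p μ))) ∧
      (∀ p q : ℝ≥0∞, 1 < p → p ≠ ∞ → 1 < q → q ≠ ∞ →
        ∃ C : ℝ≥0, ∀ F ∈ chaos μ φ m n, eLpNorm F p μ ≤ C * eLpNorm F q μ)) ∧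
    -- the projections and the semigroup on `L^p`
    (∀ (p : ℝ≥0∞) [Fact (1 ≤ p)], 1 < p → p ≠ ∞ →
      ∃ J : ℕ → ℕ → (Lp ℂ p μ →L[ℂ] Lp ℂ p μ),
        (∀ m n, IsChaosProjectionLp μ φ p m n (J m n)) ∧
        (∀ m n i j, (J m n).comp (J i j) = (if m = i ∧ n = j then J m n else 0) ∧
          (J i j).comp (J m n) = (if m = i ∧ n = j then J m n else 0)) ∧
        ∀ θ ∈ Set.Ioo (-(Real.pi / 2)) (Real.pi / 2), ∀ t : ℝ, 0 ≤ t →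
          ∃ S : Lp ℂ p μ →L[ℂ] Lp ℂ p μ, IsOUOperatorLp μ p θ t S ∧
            ∀ m n : ℕ,
              S.comp (J m n) = Complex.exp (-((m : ℂ) + n) * t * Real.cos θ -
                Complex.I * ((m : ℂ) - n) * t * Real.sin θ) • J m n ∧
              (J m n).comp S = Complex.exp (-((m : ℂ) + n) * t * Real.cos θ -
                Complex.I * ((m : ℂ) - n) * t * Real.sin θ) • J m n) := by
  have := hμ.isProbabilityMeasure
  have hLp := hμ.lpNormsEquivalent_chaos φ
  refine ⟨fun m n => ⟨fun p _ hp1 hp => ⟨fun F hF => (hLp m n).memLp hp1.le hp hF,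
    (hLp m n).isClosed_setOf (Submodule.isClosed_topologicalClosure _) p hp⟩,
    fun p q hp1 hp hq1 hq => hLp m n p q hp1.le hp hq1.le hq⟩, fun p _ hp1 hp => ?_⟩
  obtain ⟨J, hJ, hcomp, hS⟩ :=
    (hμ.mehlerEigen hφ.1).exists_projections hμ.rotationInvariant p hp1 hp
  refine ⟨J, fun m n => hJ m n, hcomp, fun θ hθ t ht => ?_⟩
  obtain ⟨S, hS1, hS2⟩ := hS _ _ (norm_exp_sq_add θ t hθ ht)
  refine ⟨S, fun F hF => hS1 F hF, fun m n => ?_⟩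
  rw [← exp_pow_mul_conj_exp_pow]
  exact hS2 m n
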